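/- Consider three agents in the plane with configuration $p=(p_1,p_2,p_3)\in\mathbb R^6$, a set $\mathcal E$ of undirected edges (distance constraints) and a set $\mathcal A$ of triples $(k,i,j)$ (angle constraints). Let $\chi_{\mathcal A}$ be the set of $p$ with $p_k\ne p_i$ and $p_k\neq p_j$ for all $(k,i,j)\in\mathcal A$. On $\chi_{\mathcal A}$ let $F_W(p)$ be the vector with entries $\|p_i-p_j\|^2$, $\{i,j\}\in\mathcal E$, and $$\cos\theta^k_{ij}(p)=\frac{(p_k-p_i)^\top(p_k-p_j)}{\|p_k-p_i\|\,\|p_k-p_j\|},\qquad (k,i,j)\in\mathcal A,$$ and let $R_W(p)=\partial F_W(p)/\partial p$. A velocity is trivial if it comes from a translation, a rotation or a sum of these (and, when $\mathcal E=\emptyset$, also a scaling). The framework $(\mathcal E,\mathcal A,p)$ with $p\in\chi_{\mathcal A}$ is generalized infinitesimally weakly rigid (GIWR) if every $v$ with $R_W(p)v=0$ is trivial. It is minimally GIWR if, moreover, after removal of any single distance or angle constraint there is a nontrivial $v$ annihilated by the remaining rows of $R_W(p)$, where "trivial" keeps the meaning it has for the original framework. Let $(\mathcal E,\mathcal A,p^*)$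 be minimally GIWR (the desired formation), put $e(p)=F_W(p)-F_W(p^*)$, and consider the gradient system $$\dot p=-R_W(p)^\top e(p)=-(E(p)\otimes I_2)\,p\qquad\text{on }\chi_{\mathcal A}.$$ Here, with $L_{ij}=(\delta_i-\delta_j)(\delta_i-\delta_j)^\top$ for the standard basis vectors $\delta_i$ of $\mathbb R^3$, $z_{ij}=p_i-p_j$, and $e_{ij}$, $e^k_{ij}$ the entries of $e(p)$, $$E(p)=\sum_{\{i,j\}\in\mathcal E}2e_{ij}L_{ij}+\sum_{(k,i,j)\in\mathcal A}e^k_{ij}\Big[\Big(\tfrac{1}{\|z_{ki}\|\|z_{kj}\|}-\tfrac{\cos\theta^k_{ij}}{\|z_{ki}\|^2}\Big)L_{ki}+\Big(\tfrac{1}{\|z_{ki}\|\|z_{kj}\|}-\tfrac{\cos\theta^k_{ij}}{\|z_{kj}\|^2}\Big)L_{kj}-\tfrac{1}{\|z_{ki}\|\|z_{kj}\|}L_{ij}\Big].$$ Let $\bar p\in\chi_{\mathcal A}$ be an incorrect equilibrium: $R_W(\bar p)^\top e(\bar p)=0$ and $e(\bar p)\ne0$. Then: 1. $\bar p$ is unstable,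 i.e. not Lyapunov stable, for the gradient system. 2. The negative Jacobian $J(\bar p)=-\partial\dot p/\partial p\,|_{p=\bar p}$ has a negative eigenvalue. 3. $\bar p_1,\bar p_2,\bar p_3$ are collinear, provided that, if there are exactly two distance constraints, the angle constraint is the one subtended by these two edges. 4. Whenever $\bar p_1,\bar p_2,\bar p_3$ are collinear, $E(\bar p)$ has a negative eigenvalue (so it is not positive semidefinite). -/

import Mathlib

noncomputable section

/-- Configurations `p = (p_1, …, p_n)` of `n` agents in the plane, as stacked vectors of `ℝ^{2n}`. -/
abbrev Config (n : ℕ) : Type := EuclideanSpace ℝ (Fin n × Fin 2)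

/-- The position `p_i ∈ ℝ²` of agent `i`. -/
def agent {n : ℕ} (p : Config n) (i : Fin n) : EuclideanSpace ℝ (Fin 2) :=
  WithLp.toLp 2 (fun a => p (i, a))

/-- The relative position `z_{ij} = p_i - p_j`. -/
def relPos {n : ℕ} (p : Config n) (i j : Fin n) : EuclideanSpace ℝ (Fin 2) :=
  agent p i - agent p j

theorem relPos_norm_comm {n : ℕ} (p : Config n) (i j : Fin n) :
    ‖relPos p i j‖ = ‖relPos p j i‖ :=
  norm_sub_rev _ _

/-- The squared length `‖z_{ij}‖²` of an undirected edge. -/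
def sqLength {n : ℕ} (p : Config n) (s : Sym2 (Fin n)) : ℝ :=
  Sym2.lift ⟨fun i j => ‖relPos p i j‖ ^ 2, fun i j => by simp only [relPos_norm_comm p i j]⟩ s

/-- The cosine `z_{ki}ᵀ z_{kj} / (‖z_{ki}‖ ‖z_{kj}‖)` of the angle `θ_{ij}^k` at agent `k`
attached to the triple `a = (k, i, j)`. -/
def cosAngle {n : ℕ} (p : Config n) (a : Fin n × Fin n × Fin n) : ℝ :=
  inner ℝ (relPos p a.1 a.2.1) (relPos p a.1 a.2.2) /
    (‖relPos p a.1 a.2.1‖ * ‖relPos p a.1 a.2.2‖)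

/-- The configurations for which no denominator in the cosines of the angle set `A` vanishes. -/
def domainSet {n : ℕ} (A : Finset (Fin n × Fin n × Fin n)) : Set (Config n) :=
  {p | ∀ a ∈ A, agent p a.1 ≠ agent p a.2.1 ∧ agent p a.1 ≠ agent p a.2.2}

/-- The constraints: the edges of `G` (distances) and the elements of `A` (angles). -/
abbrev Constraint {n : ℕ} (G : SimpleGraph (Fin n)) (A : Finset (Fin n × Fin n × Fin n)) : Type :=
  G.edgeSet ⊕ A

/-- The weak rigidity function `F_W`. -/
def weakRigidityFun {n : ℕ} (G : SimpleGraph (Fin n)) (A : Finset (Fin n × Fin n × Fin n))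
    (p : Config n) : Constraint G A → ℝ
  | Sum.inl s => sqLength p s.1
  | Sum.inr a => cosAngle p a.1

/-- The weak rigidity matrix `R_W(p)`, the Jacobian matrix of `F_W` at `p`. -/
def weakRigidityMatrix {n : ℕ} (G : SimpleGraph (Fin n)) (A : Finset (Fin n × Fin n × Fin n))
    (p : Config n) : Matrix (Constraint G A) (Fin n × Fin 2) ℝ :=
  Matrix.of fun c x =>
    fderiv ℝ (fun q : Config n => weakRigidityFun G A q c) p (EuclideanSpace.single x 1)

/-- The velocity `v` is an infinitesimal rigid motion of `p`: a translation by `b` plus a rotation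
(`ω` times the quarter turn of `p`), plus, where `scaling` holds, a scaling `c p`. -/
def IsTrivialMotion {n : ℕ} (scaling : Prop) (p v : Config n) : Prop :=
  ∃ (b : Fin 2 → ℝ) (ω c : ℝ), (¬ scaling → c = 0) ∧
    ∀ i, v (i, 0) = b 0 - ω * p (i, 1) + c * p (i, 0) ∧
      v (i, 1) = b 1 + ω * p (i, 0) + c * p (i, 1)

/-- All infinitesimal motions of the framework `(G, A, p)` are trivial, scalings being counted as
trivial when `scaling` holds. -/
def MotionsTrivial {n : ℕ} (scaling : Prop) (G : SimpleGraph (Fin n))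
    (A : Finset (Fin n × Fin n × Fin n)) (p : Config n) : Prop :=
  ∀ v : Config n, (weakRigidityMatrix G A p).mulVec v.ofLp = 0 → IsTrivialMotion scaling p v

/-- Generalized infinitesimal weak rigidity of `(G, A, p)` in the plane. Scalings count as trivial
precisely when there is no distance constraint. -/
def IsGIWR {n : ℕ} (G : SimpleGraph (Fin n)) (A : Finset (Fin n × Fin n × Fin n))
    (p : Config n) : Prop :=
  p ∈ domainSet A ∧ MotionsTrivial (G.edgeSet = ∅) G A p

/-- Minimal GIWR: `(G, A, p)` is GIWR, and after the removal of any single constraint some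
infinitesimal motion is not trivial. The notion of trivial motion is that of the
original framework, so that removing the only distance constraint does lose rigidity. -/
def IsMinimallyGIWR {n : ℕ} (G : SimpleGraph (Fin n)) (A : Finset (Fin n × Fin n × Fin n))
    (p : Config n) : Prop :=
  IsGIWR G A p ∧
    (∀ s ∈ G.edgeSet, ¬ MotionsTrivial (G.edgeSet = ∅) (G.deleteEdges {s}) A p) ∧
    (∀ a ∈ A, ¬ MotionsTrivial (G.edgeSet = ∅) G (A.erase a) p)

/-- The error vector `e(p) = F_W(p) - F_W(p*)`, for the desired configuration `p* = pd`. -/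
def errorVec {n : ℕ} (G : SimpleGraph (Fin n)) (A : Finset (Fin n × Fin n × Fin n))
    (pd p : Config n) : Constraint G A → ℝ :=
  fun c => weakRigidityFun G A p c - weakRigidityFun G A pd c

/-- The right-hand side `-R_W(p)ᵀ e(p)` of the gradient flow law. -/
def controlField {n : ℕ} (G : SimpleGraph (Fin n)) [DecidableRel G.Adj]
    (A : Finset (Fin n × Fin n × Fin n)) (pd p : Config n) : Config n :=
  WithLp.toLp 2 (-((weakRigidityMatrix G A p).transpose.mulVec (errorVec G A pd p)))

/-- The incorrect equilibria: `R_Wᵀ e = 0` and `e ≠ 0`. -/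
def incorrectEquilibria {n : ℕ} (G : SimpleGraph (Fin n)) [DecidableRel G.Adj]
    (A : Finset (Fin n × Fin n × Fin n)) (pd : Config n) : Set (Config n) :=
  {p | p ∈ domainSet A ∧
    (weakRigidityMatrix G A p).transpose.mulVec (errorVec G A pd p) = 0 ∧ errorVec G A pd p ≠ 0}

/-- The negative Jacobian `J(p) = -∂ṗ/∂p` of the gradient flow. -/
def negJacobian {n : ℕ} (G : SimpleGraph (Fin n)) [DecidableRel G.Adj]
    (A : Finset (Fin n × Fin n × Fin n)) (pd p : Config n) : Config n →L[ℝ] Config n :=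
  -fderiv ℝ (controlField G A pd) p

/-- `γ` solves `γ' = u(γ)` on `[0, T]` inside `D`. -/
def IsSolutionOn {X : Type*} [NormedAddCommGroup X] [NormedSpace ℝ X] (D : Set X) (u : X → X)
    (T : ℝ) (γ : ℝ → X) : Prop :=
  ∀ t ∈ Set.Icc 0 T, γ t ∈ D ∧ HasDerivWithinAt γ (u (γ t)) (Set.Icc 0 T) t

/-- Lyapunov stability of the point `x` for `γ' = u(γ)` on `D`: solutions that start close to `x`
stay close to `x` for as long as they exist. -/
def IsLyapunovStable {X : Type*} [NormedAddCommGroup X] [NormedSpace ℝ X] (D : Set X) (u : X → X)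
    (x : X) : Prop :=
  ∀ ε > 0, ∃ δ > 0, ∀ T ≥ 0, ∀ γ : ℝ → X, IsSolutionOn D u T γ → ‖γ 0 - x‖ < δ →
    ∀ t ∈ Set.Icc 0 T, ‖γ t - x‖ < ε

/-- The Laplacian `(δ_i - δ_j)(δ_i - δ_j)ᵀ` of the single edge `ij`. -/
def edgeLap {n : ℕ} (i j : Fin n) : Matrix (Fin n) (Fin n) ℝ :=
  Matrix.vecMulVec (Pi.single i 1 - Pi.single j 1) (Pi.single i 1 - Pi.single j 1)

theorem edgeLap_comm {n : ℕ} (i j : Fin n) : edgeLap i j = edgeLap j i := by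
  ext x y
  simp only [edgeLap, Matrix.vecMulVec_apply, Pi.sub_apply]
  ring

/-- The Laplacian of a single undirected edge. -/
def symEdgeLap {n : ℕ} (s : Sym2 (Fin n)) : Matrix (Fin n) (Fin n) ℝ :=
  Sym2.lift ⟨fun i j => edgeLap i j, fun i j => edgeLap_comm i j⟩ s

/-- The symmetric matrix with zero row sums for which `(M ⊗ I₂) p` is the gradient of
`cos θ_{ij}^k`. With `α, β, γ` the gradients of `cos θ_{ij}^k` in `p_k, p_i, p_j`, its entries
off the diagonal are the coefficient of `p_k` in `β`, that of `p_j` in `α`, and that of `p_i`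
in `γ`. -/
def angleCoeff {n : ℕ} (p : Config n) (a : Fin n × Fin n × Fin n) : Matrix (Fin n) (Fin n) ℝ :=
  (1 / (‖relPos p a.1 a.2.1‖ * ‖relPos p a.1 a.2.2‖) - cosAngle p a / ‖relPos p a.1 a.2.1‖ ^ 2) •
      edgeLap a.1 a.2.1
    + (1 / (‖relPos p a.1 a.2.1‖ * ‖relPos p a.1 a.2.2‖) - cosAngle p a / ‖relPos p a.1 a.2.2‖ ^ 2) •
      edgeLap a.1 a.2.2
    - (1 / (‖relPos p a.1 a.2.1‖ * ‖relPos p a.1 a.2.2‖)) • edgeLap a.2.1 a.2.2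

/-- The matrix `E(p)` of the gradient flow: `R_W(p)ᵀ e(p) = (E(p) ⊗ I₂) p`. -/
def coeffMatrix {n : ℕ} (G : SimpleGraph (Fin n)) [DecidableRel G.Adj]
    (A : Finset (Fin n × Fin n × Fin n)) (pd p : Config n) : Matrix (Fin n) (Fin n) ℝ :=
  (∑ s ∈ G.edgeFinset, (2 * (sqLength p s - sqLength pd s)) • symEdgeLap s)
    + ∑ a ∈ A, (cosAngle p a - cosAngle pd a) • angleCoeff p a

end

/-! The control field is minus the gradient of `errorPotential`, so its linearization is symmetric,
namely minus the Hessian. One direction of negative second derivative of the potential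
(`exists_fderiv_fderiv_errorPotential_neg`) therefore yields both the negative eigenvalue of the
negative Jacobian and, by a Chetaev argument (`not_isLyapunovStable_of_fderiv`), instability.

Collinear equilibrium. To first order no constraint feels a velocity normal to the line, and in a
direction `w ⊗ m` with `m` a unit normal the Hessian is `wᵀ E w`
(`fderiv_fderiv_errorPotential_of_normal`). The form of `E` is negative at the desired configuration
(`stressForm_coeffMatrix_desired_neg`). Testing the equilibrium equation against `p` itself, where
the angle terms vanish by Euler's identity, turns the distance terms into `-∑ 2 e²`. At a degenerate
angle the cosine is `±1`, and the angle term becomes `-(1 - cos θ cos θ*)` times a square. The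
desired configuration is not collinear, so every nonzero error contributes strictly. Hence one of
its two coordinate vectors is a suitable `w`, which also gives the negative eigenvalue of `E`.

Noncollinear equilibrium. A symmetric matrix with zero row sums that annihilates three affinely
independent points is zero, so `E = 0` and the errors are a linear dependency among the matrices of
the constraints. Minimality excludes dependencies at the desired configuration, which leaves at most
three constraints and not all three angles. Comparing entries at `p`
(`exists_right_angle_of_dependent`) leaves one exception: edges `ij` and `ki`, an angle at `k`, and
a right angle at `j`. This cannot occur when the angle lies between the two edges. In the exception,
a comparison of triangles (`cosAngle_le_of_right_angle`) fixes the sign of the angle error, hence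
`e_ij < 0`. Sliding `j` along `kj` keeps the angle and `ki` while lengthening `ij` to second order,
so the potential is negatively curved. -/

open Filter Topology Metric

/-! ### Instability of equilibria with a symmetric linearization -/

/-- A symmetric operator whose quadratic form takes a negative value has a negative eigenvalue. -/
theorem LinearMap.IsSymmetric.exists_neg_hasEigenvalue {E : Type*} [NormedAddCommGroup E]
    [InnerProductSpace ℝ E] [FiniteDimensional ℝ E] {T : E →ₗ[ℝ] E} (hT : T.IsSymmetric) {v : E}
    (hv : inner ℝ (T v) v < 0) : ∃ μ < 0, Module.End.HasEigenvalue T μ := by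
  by_contra! h
  refine hv.not_ge ?_
  set b := hT.eigenvectorBasis rfl
  have hsum := b.sum_inner_mul_inner (T v) v
  rw [← hsum]
  refine Finset.sum_nonneg fun i _ => ?_
  have h1 : inner ℝ (T v) (b i) = hT.eigenvalues rfl i * inner ℝ v (b i) := by
    rw [hT v (b i), hT.apply_eigenvectorBasis rfl i]
    simp [inner_smul_right, b]
  rw [h1, real_inner_comm, mul_assoc]
  refine mul_nonneg ?_ (mul_self_nonneg _)
  by_contra! hneg
  exact h _ hneg (hT.hasEigenvalue_eigenvalues rfl i)

/-- A vector field of class `C^1` at `x` agrees near `x` with one of class `C^1` with compact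
support. -/
theorem ContDiffAt.exists_hasCompactSupport_eqOn {E F : Type*} [NormedAddCommGroup E]
    [InnerProductSpace ℝ E] [FiniteDimensional ℝ E] [NormedAddCommGroup F] [NormedSpace ℝ F]
    {u : E → F} {x : E} (hu : ContDiffAt ℝ 1 u x) :
    ∃ w : E → F, ContDiff ℝ 1 w ∧ HasCompactSupport w ∧ w =ᶠ[𝓝 x] u := by
  have hev : ∀ᶠ y in 𝓝 x, ContDiffAt ℝ 1 u y := hu.eventually (by simp)
  obtain ⟨r, hr, hball⟩ := Metric.eventually_nhds_iff_ball.1 hev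
  -- The bump equals one on radius `r / 4` and vanishes outside `r / 2`, well inside the ball of
  -- radius `r` where `u` is of class `C^1`, so the product extends by zero.
  let f : ContDiffBump x := ⟨r / 4, r / 2, by positivity, by linarith⟩
  refine ⟨fun y => f y • u y, ?_, f.hasCompactSupport.smul_right, ?_⟩
  · rw [contDiff_iff_contDiffAt]
    intro y
    by_cases hy : y ∈ ball x r
    · exact (f.contDiff.contDiffAt).smul (hball y hy)
    · have hz : (fun y => f y • u y) =ᶠ[𝓝 y] fun _ => 0 := by
        have hmem : (closedBall x (r / 2))ᶜ ∈ 𝓝 y := by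
          refine isClosed_closedBall.isOpen_compl.mem_nhds ?_
          simp only [Set.mem_compl_iff, mem_closedBall, mem_ball, not_lt] at hy ⊢
          linarith
        filter_upwards [hmem] with z hz
        simp only [Set.mem_compl_iff, mem_closedBall, not_le] at hz
        rw [f.zero_of_le_dist hz.le, zero_smul]
      exact contDiffAt_const.congr_of_eventuallyEq hz
  · filter_upwards [f.eventuallyEq_one] with y hy
    simp [hy]

/-- A compactly supported vector field of class `C^1` has solutions on `[0, T]` for every `T`. -/
theorem ContDiff.exists_solution_of_hasCompactSupport {E : Type*} [NormedAddCommGroup E]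
    [InnerProductSpace ℝ E] [FiniteDimensional ℝ E] {w : E → E} (hw : ContDiff ℝ 1 w)
    (hc : HasCompactSupport w) (y : E) {T : ℝ} (hT : 0 ≤ T) :
    ∃ γ : ℝ → E, γ 0 = y ∧
      ∀ t ∈ Set.Icc 0 T, HasDerivWithinAt γ (w (γ t)) (Set.Icc 0 T) t := by
  obtain ⟨K, hK⟩ := hw.lipschitzWith_of_hasCompactSupport hc one_ne_zero
  obtain ⟨C, hC⟩ := hw.continuous.bounded_above_of_compact_support hc
  have hC0 : 0 ≤ C := (norm_nonneg _).trans (hC 0)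
  -- The speed is at most `C`, so over `[0, T]` a solution travels at most `C * T`; with this radius
  -- no smallness of `T` is needed.
  have hP : IsPicardLindelof (fun _ : ℝ => w) (tmin := 0) (tmax := T)
      ⟨0, Set.left_mem_Icc.2 hT⟩ y ⟨C * T, mul_nonneg hC0 hT⟩ 0 ⟨C, hC0⟩ K := by
    refine IsPicardLindelof.of_time_independent (fun x _ => hC x) hK.lipschitzOnWith ?_
    simp only [sub_zero, NNReal.coe_zero]
    rw [max_eq_left (by linarith)]
    exact le_rfl
  exact hP.exists_eq_forall_mem_Icc_hasDerivWithinAt (mem_closedBall_self (by simp))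

/-- Exponential growth of the indefinite form `⟪M y, y⟫` along a solution that stays where the
remainder is small. -/
theorem inner_growth_of_hasDerivWithinAt {E : Type*} [NormedAddCommGroup E]
    [InnerProductSpace ℝ E] {M : E →L[ℝ] E} (hM : (M : E →ₗ[ℝ] E).IsSymmetric) {μ T : ℝ}
    {y y' : ℝ → E} (hy : ∀ t ∈ Set.Icc 0 T, HasDerivWithinAt y (y' t) (Set.Icc 0 T) t)
    (hrem : ∀ t ∈ Set.Icc 0 T, ‖y' t - (M (y t) + μ • y t)‖ ≤ ‖M (y t)‖) (hT : 0 ≤ T) :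
    Real.exp (2 * μ * T) * inner ℝ (M (y 0)) (y 0) ≤ inner ℝ (M (y T)) (y T) := by
  set q : ℝ → ℝ := fun t => inner ℝ (M (y t)) (y t) with hq
  have hqd : ∀ t ∈ Set.Icc 0 T,
      HasDerivWithinAt q (2 * inner ℝ (M (y t)) (y' t)) (Set.Icc 0 T) t := by
    intro t ht
    have h1 := ((M.hasFDerivAt.comp_hasDerivWithinAt t (hy t ht)).inner ℝ (hy t ht))
    refine h1.congr_deriv ?_
    have := hM (y' t) (y t)
    simp only [ContinuousLinearMap.coe_coe] at this
    rw [Function.comp_apply, this, real_inner_comm (M (y t)) (y' t)]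
    ring
  -- Integrating factor: `q' - 2μq = 2⟪My, My + rem⟫`, which is nonnegative because `‖rem‖ ≤ ‖My‖`.
  set g : ℝ → ℝ := fun t => Real.exp (-(2 * μ * t)) * q t with hg
  have hgd : ∀ t ∈ Set.Icc 0 T, HasDerivWithinAt g
      (Real.exp (-(2 * μ * t)) * (2 * inner ℝ (M (y t)) (y' t) - 2 * μ * q t)) (Set.Icc 0 T) t := by
    intro t ht
    have h1 : HasDerivAt (fun t : ℝ => Real.exp (-(2 * μ * t)))
        (Real.exp (-(2 * μ * t)) * (-(2 * μ))) t := by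
      have := ((hasDerivAt_id t).const_mul (2 * μ)).neg.exp
      simpa using this
    refine (h1.hasDerivWithinAt.mul (hqd t ht)).congr_deriv ?_
    ring
  have hmono : MonotoneOn g (Set.Icc 0 T) := by
    refine monotoneOn_of_hasDerivWithinAt_nonneg (convex_Icc 0 T)
      (fun t ht => (hgd t ht).continuousWithinAt)
      (fun t ht => (hgd t (interior_subset ht)).mono interior_subset) fun t ht => ?_
    have ht' := interior_subset ht
    refine mul_nonneg (Real.exp_pos _).le ?_
    have h1 := real_inner_le_norm (M (y t)) (-(y' t - (M (y t) + μ • y t)))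
    rw [norm_neg] at h1
    have h2 := mul_le_mul_of_nonneg_left (hrem t ht') (norm_nonneg (M (y t)))
    rw [inner_neg_right, inner_sub_right, inner_add_right, inner_smul_right,
      real_inner_self_eq_norm_mul_norm] at h1
    simp only [hq]
    linarith
  have h0 := hmono (Set.left_mem_Icc.2 hT) (Set.right_mem_Icc.2 hT) hT
  simp only [hg, mul_zero, neg_zero, Real.exp_zero, one_mul] at h0
  calc _ ≤ Real.exp (2 * μ * T) * (Real.exp (-(2 * μ * T)) * q T) := by gcongr
    _ = q T := by rw [← mul_assoc, ← Real.exp_add]; simp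

/-- An equilibrium is not Lyapunov stable if the linearization is symmetric and its quadratic form
takes a positive value. -/
theorem not_isLyapunovStable_of_fderiv {E : Type*} [NormedAddCommGroup E]
    [InnerProductSpace ℝ E] [FiniteDimensional ℝ E] {D : Set E} {u : E → E} {x : E}
    (hD : D ∈ 𝓝 x) (hu : ContDiffAt ℝ 1 u x) (hx : u x = 0)
    (hsymm : (fderiv ℝ u x : E →ₗ[ℝ] E).IsSymmetric) {v : E}
    (hv : 0 < inner ℝ (fderiv ℝ u x v) v) : ¬ IsLyapunovStable D u x := by
  intro hstab
  set B := fderiv ℝ u x with hB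
  have hv0 : v ≠ 0 := by
    rintro rfl
    simp at hv
  have hvn : 0 < ‖v‖ ^ 2 := by positivity
  -- Taking `μ` below the Rayleigh quotient of `v` keeps the form of `B - μ` positive at `v`;
  -- avoiding the finitely many eigenvalues makes `B - μ` injective, so that `‖y‖ ≤ K ‖My‖`.
  obtain ⟨μ, ⟨hμ0, hμ1⟩, hμ2⟩ : ∃ μ ∈ Set.Ioo 0 (inner ℝ (B v) v / ‖v‖ ^ 2),
      ¬ Module.End.HasEigenvalue (B : E →ₗ[ℝ] E) μ := by
    have := ((Set.Ioo_infinite (div_pos hv hvn)).sdiff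
      (Module.End.finite_hasEigenvalue (B : E →ₗ[ℝ] E))).nonempty
    obtain ⟨μ, h1, h2⟩ := this
    exact ⟨μ, h1, h2⟩
  set M : E →L[ℝ] E := B - μ • ContinuousLinearMap.id ℝ E with hM
  have hMapp : ∀ y, M y = B y - μ • y := fun y => by simp [hM]
  have hMsymm : (M : E →ₗ[ℝ] E).IsSymmetric := by
    intro a b
    have := hsymm a b
    simp only [ContinuousLinearMap.coe_coe] at this ⊢
    rw [hMapp, hMapp, inner_sub_left, inner_sub_right, this, inner_smul_left, inner_smul_right]
    simp
  have hker : LinearMap.ker (M : E →ₗ[ℝ] E) = ⊥ := by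
    by_contra hne
    apply hμ2
    rw [Module.End.hasEigenvalue_iff, Module.End.eigenspace_def]
    convert! hne using 2
  obtain ⟨K, hK0, hK⟩ := LinearMap.exists_antilipschitzWith (M : E →ₗ[ℝ] E) hker
  have hKM : ∀ y, ‖y‖ ≤ K * ‖M y‖ := fun y => by
    have := hK.le_mul_dist y 0
    simpa [dist_eq_norm] using this
  have hMv : 0 < inner ℝ (M v) v := by
    rw [hMapp, inner_sub_left, inner_smul_left, real_inner_self_eq_norm_sq]
    have := (lt_div_iff₀ hvn).1 hμ1
    simpa using this
  obtain ⟨w, hw, hwc, hwu⟩ := hu.exists_hasCompactSupport_eqOn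
  -- The constant `K⁻¹` is chosen so that the nonlinear remainder is at most `K⁻¹ ‖y‖ ≤ ‖My‖`, as
  -- the growth estimate requires.
  have hlin : ∀ᶠ z in 𝓝 x, ‖u z - B (z - x)‖ ≤ (K : ℝ)⁻¹ * ‖z - x‖ := by
    have h1 := (hu.differentiableAt one_ne_zero).hasFDerivAt.isLittleO.def
      (inv_pos.2 (NNReal.coe_pos.2 hK0))
    filter_upwards [h1] with z hz
    simpa [hx] using hz
  obtain ⟨ρ, hρ, hball⟩ := Metric.nhds_basis_closedBall.eventually_iff.1
    (hwu.and (hlin.and (eventually_mem_set.2 hD)))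
  obtain ⟨δ, hδ, hst⟩ := hstab ρ hρ
  obtain ⟨s, hs0, hsδ⟩ : ∃ s : ℝ, 0 < s ∧ s * ‖v‖ < min δ ρ := by
    have hm : 0 < min δ ρ := lt_min hδ hρ
    refine ⟨min δ ρ / (2 * ‖v‖), by positivity, ?_⟩
    have : 0 < ‖v‖ := norm_pos_iff.2 hv0
    field_simp
    norm_num
  have hq0 : 0 < inner ℝ (M (s • v)) (s • v) := by
    rw [map_smul, inner_smul_left, inner_smul_right]
    simp only [conj_trivial]
    positivity
  set q0 := inner ℝ (M (s • v)) (s • v) with hq0'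
  -- By time `T` the growing form would exceed `‖M‖ρ²`, its largest possible value on the ball of
  -- radius `ρ`.
  obtain ⟨T, hT0, hT⟩ : ∃ T : ℝ, 0 ≤ T ∧ ‖M‖ * ρ * ρ < Real.exp (2 * μ * T) * q0 := by
    have h1 : Tendsto (fun T : ℝ => Real.exp (2 * μ * T) * q0) atTop atTop :=
      (Real.tendsto_exp_atTop.comp
        (tendsto_id.const_mul_atTop (by positivity))).atTop_mul_const hq0
    obtain ⟨T, h2, h3⟩ := ((h1.eventually_gt_atTop _).and (eventually_ge_atTop 0)).exists
    exact ⟨T, h3, h2⟩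
  obtain ⟨γ, hγ0, hγ⟩ := hw.exists_solution_of_hasCompactSupport hwc (x + s • v) hT0
  have hcont : ContinuousOn γ (Set.Icc 0 T) := fun t ht => (hγ t ht).continuousWithinAt
  have hγ0' : γ 0 - x = s • v := by rw [hγ0]; simp
  have hγmin : ‖γ 0 - x‖ < min δ ρ := by
    rw [hγ0', norm_smul, Real.norm_of_nonneg hs0.le]
    exact hsδ
  have hγδ : ‖γ 0 - x‖ < δ := hγmin.trans_le (min_le_left _ _)
  by_cases hstay : ∀ t ∈ Set.Icc 0 T, γ t ∈ closedBall x ρ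
  · have hgrow := inner_growth_of_hasDerivWithinAt (y := fun t => γ t - x)
      (y' := fun t => w (γ t)) hMsymm (μ := μ) (fun t ht => (hγ t ht).sub_const x)
      (fun t ht => ?_) hT0
    · simp only [hγ0'] at hgrow
      have h1 : inner ℝ (M (γ T - x)) (γ T - x) ≤ ‖M‖ * ρ * ρ := by
        have h2 : ‖γ T - x‖ ≤ ρ := by
          simpa [dist_eq_norm] using hstay T (Set.right_mem_Icc.2 hT0)
        calc _ ≤ ‖M (γ T - x)‖ * ‖γ T - x‖ := real_inner_le_norm _ _
          _ ≤ (‖M‖ * ‖γ T - x‖) * ‖γ T - x‖ := by gcongr; exact M.le_opNorm _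
          _ ≤ _ := by gcongr
      linarith
    · obtain ⟨h1, h2, -⟩ := hball (hstay t ht)
      have h3 : w (γ t) - (M (γ t - x) + μ • (γ t - x)) = u (γ t) - B (γ t - x) := by
        rw [h1, hMapp]
        abel
      rw [h3]
      refine h2.trans ?_
      rw [inv_mul_le_iff₀ (NNReal.coe_pos.2 hK0)]
      exact hKM _
  · push Not at hstay
    -- Up to the first exit time `τ = sInf S` the curve stays in the closed ball, where `w = u` and
    -- `D` holds, so it is a solution of the original equation; at `τ` it violates stability.
    set S := {t ∈ Set.Icc 0 T | ρ ≤ ‖γ t - x‖} with hS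
    have hSne : S.Nonempty := by
      obtain ⟨t, ht, h1⟩ := hstay
      refine ⟨t, ht, ?_⟩
      rw [mem_closedBall, dist_eq_norm, not_le] at h1
      exact h1.le
    have hScl : IsClosed S := by
      have := (hcont.sub (continuousOn_const (c := x))).norm.preimage_isClosed_of_isClosed
        isClosed_Icc (isClosed_Ici (a := ρ))
      exact this
    have hSb : BddBelow S := ⟨0, fun t ht => ht.1.1⟩
    have hmem := hScl.csInf_mem hSne hSb
    set τ := sInf S with hτ
    have hlt : ∀ t ∈ Set.Ico 0 τ, ‖γ t - x‖ < ρ := by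
      intro t ht
      by_contra! h1
      exact (not_le.2 ht.2) (csInf_le hSb ⟨⟨ht.1, ht.2.le.trans hmem.1.2⟩, h1⟩)
    have hτ0 : 0 < τ := by
      refine hmem.1.1.lt_of_ne fun h1 => ?_
      have h2 := hmem.2
      rw [← h1] at h2
      exact absurd (hγmin.trans_le (min_le_right _ _)) (not_lt.2 h2)
    have hle : ‖γ τ - x‖ ≤ ρ := by
      have hsub : Set.Icc 0 τ ⊆ Set.Icc 0 T := Set.Icc_subset_Icc_right hmem.1.2
      have h1 : ContinuousOn (fun t => ‖γ t - x‖) (closure (Set.Ico 0 τ)) := by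
        rw [closure_Ico hτ0.ne]
        exact ((hcont.mono hsub).sub continuousOn_const).norm
      refine le_on_closure (fun t ht => (hlt t ht).le) h1 continuousOn_const ?_
      rw [closure_Ico hτ0.ne]
      exact Set.right_mem_Icc.2 hτ0.le
    have hfin := hst τ hτ0.le γ ?_ hγδ τ (Set.right_mem_Icc.2 hτ0.le)
    · exact (not_lt.2 hmem.2) hfin
    · intro t ht
      have h1 : γ t ∈ closedBall x ρ := by
        rw [mem_closedBall, dist_eq_norm]
        rcases ht.2.eq_or_lt with h2 | h2
        · rw [h2]; exact hle
        · exact (hlt t ⟨ht.1, h2⟩).le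
      obtain ⟨h2, -, h3⟩ := hball h1
      refine ⟨h3, ?_⟩
      rw [← h2]
      exact (hγ t ⟨ht.1, ht.2.trans hmem.1.2⟩).mono (Set.Icc_subset_Icc_right hmem.1.2)

/-! ### Stress forms and the derivatives of the constraints -/

/-- The relative position as a continuous linear map of the configuration. -/
noncomputable def relPosL {n : ℕ} (i j : Fin n) : Config n →L[ℝ] EuclideanSpace ℝ (Fin 2) :=
  LinearMap.toContinuousLinearMap
    { toFun := fun p => relPos p i j
      map_add' := fun p q => by
        ext a
        simp only [relPos, agent, PiLp.sub_apply, PiLp.add_apply]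
        ring
      map_smul' := fun c p => by
        ext a
        simp only [relPos, agent, PiLp.sub_apply, PiLp.smul_apply, smul_eq_mul, RingHom.id_apply]
        ring }

theorem relPosL_apply {n : ℕ} (i j : Fin n) (p : Config n) : relPosL i j p = relPos p i j := rfl

theorem relPos_add_smul {n : ℕ} (p v : Config n) (s : ℝ) (i j : Fin n) :
    relPos (p + s • v) i j = relPos p i j + s • relPos v i j := by
  simp only [← relPosL_apply, map_add, map_smul]

theorem relPos_sub_relPos {n : ℕ} (p : Config n) (k i j : Fin n) :
    relPos p k j - relPos p k i = relPos p i j := by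
  simp only [relPos]
  abel

theorem hasFDerivAt_relPos {n : ℕ} (i j : Fin n) (p : Config n) :
    HasFDerivAt (fun q => relPos q i j) (relPosL i j) p :=
  (relPosL i j).hasFDerivAt

theorem contDiff_relPos {n : ℕ} (i j : Fin n) {m : WithTop ℕ∞} :
    ContDiff ℝ m fun q : Config n => relPos q i j :=
  (relPosL i j).contDiff

/-- The bilinear form `∑ₐ (pᵃ)ᵀ M vᵃ`, the sum running over the two coordinates, that a matrix
indexed by the agents induces on configurations. -/
noncomputable def stressForm {n : ℕ} (M : Matrix (Fin n) (Fin n) ℝ) (p v : Config n) : ℝ :=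
  ∑ a : Fin 2, (fun i => p (i, a)) ⬝ᵥ M.mulVec fun i => v (i, a)

theorem stressForm_add {n : ℕ} (M N : Matrix (Fin n) (Fin n) ℝ) (p v : Config n) :
    stressForm (M + N) p v = stressForm M p v + stressForm N p v := by
  simp only [stressForm, Matrix.add_mulVec, dotProduct_add, Finset.sum_add_distrib]

theorem stressForm_sub {n : ℕ} (M N : Matrix (Fin n) (Fin n) ℝ) (p v : Config n) :
    stressForm (M - N) p v = stressForm M p v - stressForm N p v := by
  simp only [stressForm, Matrix.sub_mulVec, dotProduct_sub, Finset.sum_sub_distrib]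

theorem stressForm_smul {n : ℕ} (c : ℝ) (M : Matrix (Fin n) (Fin n) ℝ) (p v : Config n) :
    stressForm (c • M) p v = c * stressForm M p v := by
  simp only [stressForm, Matrix.smul_mulVec, dotProduct_smul, Finset.mul_sum, smul_eq_mul]

theorem stressForm_zero {n : ℕ} (p v : Config n) : stressForm 0 p v = 0 := by
  simp [stressForm]

theorem stressForm_sum {n : ℕ} {ι : Type*} (s : Finset ι) (M : ι → Matrix (Fin n) (Fin n) ℝ)
    (p v : Config n) : stressForm (∑ i ∈ s, M i) p v = ∑ i ∈ s, stressForm (M i) p v := by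
  classical
  induction s using Finset.induction_on with
  | empty => simp [stressForm_zero]
  | insert a s ha ih => rw [Finset.sum_insert ha, Finset.sum_insert ha, stressForm_add, ih]

theorem dotProduct_edgeLap_mulVec {n : ℕ} (i j : Fin n) (x y : Fin n → ℝ) :
    x ⬝ᵥ (edgeLap i j).mulVec y = (x i - x j) * (y i - y j) := by
  simp [edgeLap, Matrix.vecMulVec_mulVec, sub_dotProduct, dotProduct_sub, dotProduct_smul]

theorem stressForm_edgeLap {n : ℕ} (i j : Fin n) (p v : Config n) :
    stressForm (edgeLap i j) p v = inner ℝ (relPos p i j) (relPos v i j) := by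
  simp only [stressForm, dotProduct_edgeLap_mulVec, PiLp.inner_apply, relPos, agent,
    PiLp.sub_apply, RCLike.inner_apply, conj_trivial]
  exact Finset.sum_congr rfl fun _ _ => mul_comm _ _

theorem stressForm_angleCoeff {n : ℕ} (p q v : Config n) (a : Fin n × Fin n × Fin n) :
    stressForm (angleCoeff p a) q v =
      (1 / (‖relPos p a.1 a.2.1‖ * ‖relPos p a.1 a.2.2‖)
          - cosAngle p a / ‖relPos p a.1 a.2.1‖ ^ 2)
        * inner ℝ (relPos q a.1 a.2.1) (relPos v a.1 a.2.1)
      + (1 / (‖relPos p a.1 a.2.1‖ * ‖relPos p a.1 a.2.2‖)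
          - cosAngle p a / ‖relPos p a.1 a.2.2‖ ^ 2)
        * inner ℝ (relPos q a.1 a.2.2) (relPos v a.1 a.2.2)
      - 1 / (‖relPos p a.1 a.2.1‖ * ‖relPos p a.1 a.2.2‖)
        * inner ℝ (relPos q a.2.1 a.2.2) (relPos v a.2.1 a.2.2) := by
  simp only [angleCoeff, stressForm_sub, stressForm_add, stressForm_smul, stressForm_edgeLap]

theorem contDiff_sqLength {n : ℕ} (s : Sym2 (Fin n)) {m : WithTop ℕ∞} :
    ContDiff ℝ m fun q : Config n => sqLength q s := by
  induction s with
  | _ i j => exact (contDiff_relPos i j).norm_sq ℝ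

theorem fderiv_sqLength {n : ℕ} (p v : Config n) (s : Sym2 (Fin n)) :
    fderiv ℝ (fun q => sqLength q s) p v = 2 * stressForm (symEdgeLap s) p v := by
  induction s with
  | _ i j =>
    have h : HasFDerivAt (fun q : Config n => ‖relPos q i j‖ ^ 2) _ p :=
      (hasFDerivAt_relPos i j p).norm_sq
    change fderiv ℝ (fun q : Config n => ‖relPos q i j‖ ^ 2) p v = _
    rw [h.fderiv]
    change _ = 2 * stressForm (edgeLap i j) p v
    rw [stressForm_edgeLap]
    simp [relPosL_apply]

theorem relPos_ne_zero_of_mem_domainSet {n : ℕ} {A : Finset (Fin n × Fin n × Fin n)}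
    {p : Config n} (hp : p ∈ domainSet A) {a : Fin n × Fin n × Fin n} (ha : a ∈ A) :
    relPos p a.1 a.2.1 ≠ 0 ∧ relPos p a.1 a.2.2 ≠ 0 :=
  ⟨sub_ne_zero.2 (hp a ha).1, sub_ne_zero.2 (hp a ha).2⟩

theorem contDiffAt_cosAngle {n : ℕ} {p : Config n} {a : Fin n × Fin n × Fin n} {m : WithTop ℕ∞}
    (h1 : relPos p a.1 a.2.1 ≠ 0) (h2 : relPos p a.1 a.2.2 ≠ 0) :
    ContDiffAt ℝ m (fun q => cosAngle q a) p :=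
  ((contDiff_relPos _ _).contDiffAt.inner ℝ (contDiff_relPos _ _).contDiffAt).div
    (((contDiff_relPos _ _).contDiffAt.norm ℝ h1).mul ((contDiff_relPos _ _).contDiffAt.norm ℝ h2))
    (mul_ne_zero (norm_ne_zero_iff.2 h1) (norm_ne_zero_iff.2 h2))

/-- Along the line `p + s • v` the cosine is a quotient of functions of one real variable; its
derivative at `s = 0` is matched with the stress form after writing `z_ij` as `z_kj - z_ki`. -/
theorem fderiv_cosAngle {n : ℕ} {p : Config n} {a : Fin n × Fin n × Fin n}
    (h1 : relPos p a.1 a.2.1 ≠ 0) (h2 : relPos p a.1 a.2.2 ≠ 0) (v : Config n) :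
    fderiv ℝ (fun q => cosAngle q a) p v = stressForm (angleCoeff p a) p v := by
  obtain ⟨k, i, j⟩ := a
  change relPos p k i ≠ 0 at h1
  change relPos p k j ≠ 0 at h2
  have hline : HasDerivAt (fun s : ℝ => p + s • v) v 0 := by
    simpa using ((hasDerivAt_id (0 : ℝ)).smul_const v).const_add p
  have hd : HasDerivAt (fun s : ℝ => cosAngle (p + s • v) (k, i, j))
      (fderiv ℝ (fun q => cosAngle q (k, i, j)) p v) 0 := by
    have hf := ((contDiffAt_cosAngle (m := 1) (a := (k, i, j)) h1 h2).differentiableAt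
      one_ne_zero).hasFDerivAt
    have h0 : p = p + (0 : ℝ) • v := by simp
    rw [h0] at hf
    have := hf.comp_hasDerivAt (0 : ℝ) hline
    rw [← h0] at this
    exact this
  have hrel : ∀ i j : Fin n,
      HasDerivAt (fun s : ℝ => relPos (p + s • v) i j) (relPos v i j) 0 := fun i j =>
    (relPosL i j).hasFDerivAt.comp_hasDerivAt (0 : ℝ) hline
  have hnorm : ∀ i j : Fin n, relPos p i j ≠ 0 → HasDerivAt (fun s : ℝ => ‖relPos (p + s • v) i j‖)
      (inner ℝ (relPos p i j) (relPos v i j) / ‖relPos p i j‖) 0 := by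
    intro i j h
    -- The norm is differentiated as the square root of its square, which is legitimate away from
    -- zero.
    have hs := (hrel i j).norm_sq.sqrt (by simpa using h)
    simp only [zero_smul, add_zero, Real.sqrt_sq (norm_nonneg _)] at hs
    refine hs.congr_deriv ?_
    have := norm_ne_zero_iff.2 h
    field_simp
  have hn1 := norm_ne_zero_iff.2 h1
  have hn2 := norm_ne_zero_iff.2 h2
  have hq : HasDerivAt (fun s : ℝ => cosAngle (p + s • v) (k, i, j)) _ 0 :=
    ((hrel k i).inner ℝ (hrel k j)).div ((hnorm k i h1).mul (hnorm k j h2))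
      (by simpa using mul_ne_zero hn1 hn2)
  rw [hd.unique hq, stressForm_angleCoeff]
  simp only [zero_smul, add_zero, cosAngle, ← relPos_sub_relPos _ k i j, inner_sub_left,
    inner_sub_right]
  rw [real_inner_comm (relPos v k i) (relPos p k j)]
  field_simp
  ring

/-- The matrix `∑ 2 λ_s L_s + ∑ λ_a C_a(p)` for weights `λ` of the constraints. -/
noncomputable def weightedMatrix {n : ℕ} (G : SimpleGraph (Fin n)) [DecidableRel G.Adj]
    (A : Finset (Fin n × Fin n × Fin n)) (p : Config n) (l : Constraint G A → ℝ) :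
    Matrix (Fin n) (Fin n) ℝ :=
  (∑ s : G.edgeSet, (2 * l (Sum.inl s)) • symEdgeLap s.1)
    + ∑ a : A, l (Sum.inr a) • angleCoeff p a.1

theorem coeffMatrix_eq_weightedMatrix {n : ℕ} (G : SimpleGraph (Fin n)) [DecidableRel G.Adj]
    (A : Finset (Fin n × Fin n × Fin n)) (pd p : Config n) :
    coeffMatrix G A pd p = weightedMatrix G A p (errorVec G A pd p) := by
  rw [coeffMatrix, weightedMatrix]
  congr 1
  · rw [← Finset.sum_coe_sort, ← Fintype.sum_equiv
      (Equiv.subtypeEquivRight fun s => (SimpleGraph.mem_edgeFinset (G := G) (e := s)))]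
    intro x
    rfl
  · rw [← Finset.sum_coe_sort]
    rfl

theorem contDiffAt_weakRigidityFun {n : ℕ} {G : SimpleGraph (Fin n)}
    {A : Finset (Fin n × Fin n × Fin n)} {p : Config n} (hp : p ∈ domainSet A) {m : WithTop ℕ∞}
    (c : Constraint G A) : ContDiffAt ℝ m (fun q => weakRigidityFun G A q c) p := by
  rcases c with s | a
  · exact (contDiff_sqLength s.1).contDiffAt
  · exact contDiffAt_cosAngle (relPos_ne_zero_of_mem_domainSet hp a.2).1
      (relPos_ne_zero_of_mem_domainSet hp a.2).2

theorem weakRigidityMatrix_mulVec {n : ℕ} (G : SimpleGraph (Fin n))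
    (A : Finset (Fin n × Fin n × Fin n)) (p v : Config n) (c : Constraint G A) :
    (weakRigidityMatrix G A p).mulVec v.ofLp c
      = fderiv ℝ (fun q => weakRigidityFun G A q c) p v := by
  have hv : v = ∑ x, v x • EuclideanSpace.single x (1 : ℝ) := by
    ext y
    simp [Finset.sum_apply, Pi.single_apply]
  conv_rhs => rw [hv, map_sum]
  simp [Matrix.mulVec, dotProduct, weakRigidityMatrix, mul_comm]

/-- Linear combinations of the rows of the rigidity matrix become matrices on the agents;
dependencies of constraints and the equilibrium equation are studied through this identity. -/
theorem dotProduct_weakRigidityMatrix_mulVec {n : ℕ} {G : SimpleGraph (Fin n)}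
    [DecidableRel G.Adj] {A : Finset (Fin n × Fin n × Fin n)} {p : Config n}
    (hp : p ∈ domainSet A) (l : Constraint G A → ℝ) (v : Config n) :
    l ⬝ᵥ (weakRigidityMatrix G A p).mulVec v.ofLp = stressForm (weightedMatrix G A p l) p v := by
  have h : ∀ c, (weakRigidityMatrix G A p).mulVec v.ofLp c
      = fderiv ℝ (fun q => weakRigidityFun G A q c) p v := weakRigidityMatrix_mulVec G A p v
  simp only [dotProduct, h, Fintype.sum_sum_type, weightedMatrix, stressForm_add, stressForm_sum,
    stressForm_smul, weakRigidityFun, fderiv_sqLength]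
  congr 1
  · exact Finset.sum_congr rfl fun _ _ => by ring
  · refine Finset.sum_congr rfl fun a _ => ?_
    rw [fderiv_cosAngle (relPos_ne_zero_of_mem_domainSet hp a.2).1
      (relPos_ne_zero_of_mem_domainSet hp a.2).2]

/-! ### The gradient structure of the control field -/

/-- The potential `‖e(p)‖² / 2` whose negative gradient is the control field. -/
noncomputable def errorPotential {n : ℕ} (G : SimpleGraph (Fin n)) [DecidableRel G.Adj]
    (A : Finset (Fin n × Fin n × Fin n)) (pd p : Config n) : ℝ :=
  ∑ c, errorVec G A pd p c ^ 2 / 2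

theorem isOpen_domainSet {n : ℕ} (A : Finset (Fin n × Fin n × Fin n)) : IsOpen (domainSet A) := by
  have h : domainSet A = ⋂ a ∈ A, {p : Config n | relPos p a.1 a.2.1 ≠ 0 ∧ relPos p a.1 a.2.2 ≠ 0} := by
    ext p
    simp only [domainSet, relPos, Set.mem_ofPred_eq, Set.mem_iInter, sub_ne_zero]
  rw [h]
  refine isOpen_biInter_finset fun a _ => ?_
  exact (isOpen_ne_fun (relPosL a.1 a.2.1).continuous continuous_const).inter
    (isOpen_ne_fun (relPosL a.1 a.2.2).continuous continuous_const)

theorem contDiffAt_errorPotential {n : ℕ} {G : SimpleGraph (Fin n)} [DecidableRel G.Adj]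
    {A : Finset (Fin n × Fin n × Fin n)} (pd : Config n) {p : Config n} (hp : p ∈ domainSet A)
    {m : WithTop ℕ∞} : ContDiffAt ℝ m (errorPotential G A pd) p := by
  refine ContDiffAt.sum fun c _ => ?_
  exact (((contDiffAt_weakRigidityFun hp c).sub contDiffAt_const).pow 2).div_const 2

theorem fderiv_errorPotential {n : ℕ} {G : SimpleGraph (Fin n)} [DecidableRel G.Adj]
    {A : Finset (Fin n × Fin n × Fin n)} (pd : Config n) {p : Config n} (hp : p ∈ domainSet A)
    (v : Config n) : fderiv ℝ (errorPotential G A pd) p v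
      = errorVec G A pd p ⬝ᵥ (weakRigidityMatrix G A p).mulVec v.ofLp := by
  have h : ∀ c ∈ Finset.univ, HasFDerivAt (fun q => errorVec G A pd q c ^ 2 / 2)
      (errorVec G A pd p c • fderiv ℝ (fun q => weakRigidityFun G A q c) p) p := by
    intro c _
    have h1 := ((contDiffAt_weakRigidityFun (m := 1) hp c).differentiableAt
      one_ne_zero).hasFDerivAt
    refine (((h1.sub_const (weakRigidityFun G A pd c)).pow 2).mul_const (2 : ℝ)⁻¹).congr_fderiv ?_
    ext w
    simp [errorVec]
    ring
  have h2 : HasFDerivAt (errorPotential G A pd) _ p := HasFDerivAt.fun_sum h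
  rw [h2.fderiv]
  have h3 : ∀ c, (weakRigidityMatrix G A p).mulVec v.ofLp c
      = fderiv ℝ (fun q => weakRigidityFun G A q c) p v := weakRigidityMatrix_mulVec G A p v
  simp [dotProduct, h3]

theorem inner_controlField {n : ℕ} {G : SimpleGraph (Fin n)} [DecidableRel G.Adj]
    {A : Finset (Fin n × Fin n × Fin n)} (pd : Config n) {p : Config n} (hp : p ∈ domainSet A)
    (v : Config n) :
    inner ℝ (controlField G A pd p) v = -fderiv ℝ (errorPotential G A pd) p v := by
  rw [fderiv_errorPotential pd hp, Matrix.dotProduct_mulVec, ← Matrix.mulVec_transpose,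
    dotProduct_comm]
  simp [PiLp.inner_apply, controlField, dotProduct]

theorem contDiffAt_controlField {n : ℕ} {G : SimpleGraph (Fin n)} [DecidableRel G.Adj]
    {A : Finset (Fin n × Fin n × Fin n)} (pd : Config n) {p : Config n} (hp : p ∈ domainSet A) :
    ContDiffAt ℝ 1 (controlField G A pd) p := by
  rw [contDiffAt_euclidean]
  intro x
  have h1 : ContDiffAt ℝ 1 (fderiv ℝ (errorPotential G A pd)) p :=
    (contDiffAt_errorPotential (m := 2) (G := G) pd hp).fderiv_right (by norm_num)
  refine (h1.clm_apply (contDiffAt_const (c := EuclideanSpace.single x (1 : ℝ)))).neg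
    |>.congr_of_eventuallyEq ?_
  filter_upwards [(isOpen_domainSet A).mem_nhds hp] with q hq
  rw [← inner_controlField pd hq, EuclideanSpace.inner_single_right]
  simp

/-- The gradient identity holds on an open set, hence may be differentiated once more; the symmetry
of the Hessian then makes the linearization symmetric. -/
theorem inner_fderiv_controlField {n : ℕ} {G : SimpleGraph (Fin n)} [DecidableRel G.Adj]
    {A : Finset (Fin n × Fin n × Fin n)} (pd : Config n) {p : Config n} (hp : p ∈ domainSet A)
    (v w : Config n) : inner ℝ (fderiv ℝ (controlField G A pd) p v) w
      = -fderiv ℝ (fderiv ℝ (errorPotential G A pd)) p v w := by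
  have h1 := ((contDiffAt_controlField (G := G) pd hp).differentiableAt one_ne_zero).hasFDerivAt
  have h2 : ContDiffAt ℝ 1 (fderiv ℝ (errorPotential G A pd)) p :=
    (contDiffAt_errorPotential (m := 2) (G := G) pd hp).fderiv_right (by norm_num)
  have h3 := (h2.differentiableAt one_ne_zero).hasFDerivAt
  have h4 := h1.inner ℝ (hasFDerivAt_const w p)
  have h5 := (h3.clm_apply (hasFDerivAt_const w p)).neg
  have h6 : (fun q => inner ℝ (controlField G A pd q) w)
      =ᶠ[𝓝 p] fun q => -fderiv ℝ (errorPotential G A pd) q w := by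
    filter_upwards [(isOpen_domainSet A).mem_nhds hp] with q hq
    exact inner_controlField pd hq w
  have h7 := congrArg (fun f => f v) (h4.unique (h5.congr_of_eventuallyEq h6))
  simpa using h7

theorem isSymmetric_fderiv_controlField {n : ℕ} {G : SimpleGraph (Fin n)} [DecidableRel G.Adj]
    {A : Finset (Fin n × Fin n × Fin n)} (pd : Config n) {p : Config n} (hp : p ∈ domainSet A) :
    (fderiv ℝ (controlField G A pd) p : Config n →ₗ[ℝ] Config n).IsSymmetric := by
  intro v w
  have h := (contDiffAt_errorPotential (m := 2) (G := G) pd hp).isSymmSndFDerivAt (by simp) v w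
  simp only [ContinuousLinearMap.coe_coe]
  rw [← real_inner_comm v, inner_fderiv_controlField pd hp, inner_fderiv_controlField pd hp, h]

/-! ### Second derivatives along even curves -/

/-- If `f (p + s v) = h (s²)` for small `s`, then `D²f(p)(v, v) = 2 h'(0)`. -/
theorem fderiv_fderiv_apply_self_of_eq_comp_sq {E : Type*} [NormedAddCommGroup E]
    [NormedSpace ℝ E] {f : E → ℝ} {p v : E} {h : ℝ → ℝ} (hf : ContDiffAt ℝ 2 f p)
    (hh : ContDiffAt ℝ 1 h 0) (heq : ∀ᶠ s in 𝓝 (0 : ℝ), f (p + s • v) = h (s ^ 2)) :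
    fderiv ℝ (fderiv ℝ f) p v v = 2 * deriv h 0 := by
  have hline : ∀ s : ℝ, HasDerivAt (fun s : ℝ => p + s • v) v s := fun s => by
    simpa using ((hasDerivAt_id s).smul_const v).const_add p
  have hlim : Tendsto (fun s : ℝ => p + s • v) (𝓝 0) (𝓝 p) := by
    simpa using (hline 0).continuousAt.tendsto
  have hsq : Tendsto (fun s : ℝ => s ^ 2) (𝓝 0) (𝓝 0) := by
    simpa using (continuous_pow 2 (M := ℝ)).tendsto 0
  have hf1 : ∀ᶠ q in 𝓝 p, ContDiffAt ℝ 2 f q := hf.eventually (by simp)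
  have hh1 : ∀ᶠ τ in 𝓝 (0 : ℝ), ContDiffAt ℝ 1 h τ := hh.eventually (by simp)
  have hfirst : ∀ᶠ s in 𝓝 (0 : ℝ), fderiv ℝ f (p + s • v) v = 2 * s * deriv h (s ^ 2) := by
    filter_upwards [heq.eventually_nhds, hlim.eventually hf1, hsq.eventually hh1] with s h1 h2 h3
    have h4 := ((h2.differentiableAt two_ne_zero).hasFDerivAt).comp_hasDerivAt s (hline s)
    have h5 := ((h3.differentiableAt one_ne_zero).hasDerivAt).comp s (h₂ := h)
      (h := fun s : ℝ => s ^ 2) (hasDerivAt_pow 2 s)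
    have h6 := h4.unique (h5.congr_of_eventuallyEq h1)
    rw [h6]
    simp
    ring
  have hd : HasDerivAt (fun s : ℝ => fderiv ℝ f (p + s • v) v)
      (fderiv ℝ (fderiv ℝ f) p v v) 0 := by
    have h1 : ContDiffAt ℝ 1 (fderiv ℝ f) p := hf.fderiv_right (by norm_num)
    have h2 := (h1.differentiableAt one_ne_zero).hasFDerivAt
    have h3 := (h2.comp_hasDerivAt_of_eq (0 : ℝ) (hline 0) (by simp)).clm_apply
      (hasDerivAt_const (0 : ℝ) v)
    simpa using h3
  -- Since `h` is only `C^1`, the product rule is not available for `h'`; the difference quotient at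
  -- `0` is `2 h'(t²)`, and continuity of `h'` gives its limit.
  have hd2 : HasDerivAt (fun s : ℝ => 2 * s * deriv h (s ^ 2)) (2 * deriv h 0) 0 := by
    have hc : ContinuousAt (deriv h) 0 :=
      (hh.continuousAt_fderiv one_ne_zero).clm_apply continuousAt_const
    rw [hasDerivAt_iff_tendsto_slope_zero]
    have h1 : Tendsto (fun t : ℝ => 2 * deriv h (t ^ 2)) (𝓝[≠] 0) (𝓝 (2 * deriv h 0)) :=
      ((hc.tendsto.comp hsq).const_mul 2).mono_left nhdsWithin_le_nhds
    refine h1.congr' ?_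
    filter_upwards [self_mem_nhdsWithin] with t ht
    have ht0 : t ≠ 0 := ht
    simp
    field_simp
  exact hd.unique (hd2.congr_of_eventuallyEq hfirst)

/-! ### Symmetric matrices on the agents and the equilibrium equation -/

theorem isHermitian_edgeLap {n : ℕ} (i j : Fin n) : (edgeLap i j).IsHermitian := by
  ext x y
  simp [edgeLap, Matrix.vecMulVec_apply, mul_comm]

theorem isHermitian_symEdgeLap {n : ℕ} (s : Sym2 (Fin n)) : (symEdgeLap s).IsHermitian := by
  induction s with
  | _ i j => exact isHermitian_edgeLap i j

theorem isHermitian_angleCoeff {n : ℕ} (p : Config n) (a : Fin n × Fin n × Fin n) :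
    (angleCoeff p a).IsHermitian :=
  (((isHermitian_edgeLap _ _).smul (IsSelfAdjoint.all _)).add
    ((isHermitian_edgeLap _ _).smul (IsSelfAdjoint.all _))).sub
    ((isHermitian_edgeLap _ _).smul (IsSelfAdjoint.all _))

theorem isHermitian_weightedMatrix {n : ℕ} (G : SimpleGraph (Fin n)) [DecidableRel G.Adj]
    (A : Finset (Fin n × Fin n × Fin n)) (p : Config n) (l : Constraint G A → ℝ) :
    (weightedMatrix G A p l).IsHermitian := by
  refine Matrix.IsHermitian.add ?_ ?_
  · rw [Matrix.IsHermitian, Matrix.conjTranspose_sum]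
    refine Finset.sum_congr rfl fun s _ => ?_
    exact Matrix.IsHermitian.smul (isHermitian_symEdgeLap s.1) (IsSelfAdjoint.all _)
  · rw [Matrix.IsHermitian, Matrix.conjTranspose_sum]
    refine Finset.sum_congr rfl fun a _ => ?_
    exact Matrix.IsHermitian.smul (isHermitian_angleCoeff p a.1) (IsSelfAdjoint.all _)

theorem isHermitian_coeffMatrix {n : ℕ} (G : SimpleGraph (Fin n)) [DecidableRel G.Adj]
    (A : Finset (Fin n × Fin n × Fin n)) (pd p : Config n) :
    (coeffMatrix G A pd p).IsHermitian := by
  rw [coeffMatrix_eq_weightedMatrix]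
  exact isHermitian_weightedMatrix _ _ _ _

/-- A real symmetric matrix whose quadratic form takes a negative value has a negative
eigenvalue. -/
theorem Matrix.IsHermitian.exists_neg_hasEigenvalue {ι : Type*} [Fintype ι] [DecidableEq ι]
    {M : Matrix ι ι ℝ} (hM : M.IsHermitian) {x : ι → ℝ} (hx : x ⬝ᵥ M.mulVec x < 0) :
    ∃ μ < 0, Module.End.HasEigenvalue (Matrix.toLin' M) μ := by
  by_contra! h
  have hnn : 0 ≤ hM.eigenvalues := by
    intro i
    by_contra hi
    refine h _ (not_le.1 hi) (Module.End.hasEigenvalue_of_hasEigenvector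
      (x := (hM.eigenvectorBasis i).ofLp) ⟨?_, ?_⟩)
    · rw [Module.End.mem_eigenspace_iff, Matrix.toLin'_apply]
      exact hM.mulVec_eigenvectorBasis i
    · intro h0
      apply hM.eigenvectorBasis.orthonormal.ne_zero i
      ext j
      exact congrFun h0 j
  have := (hM.posSemidef_iff_eigenvalues_nonneg.2 hnn).dotProduct_mulVec_nonneg x
  simp only [star_trivial] at this
  exact absurd hx (not_lt.2 this)

/-- This is the equilibrium equation in weak form, obtained by moving the transpose onto the test
velocity `v`. -/
theorem stressForm_coeffMatrix_eq_zero {n : ℕ} {G : SimpleGraph (Fin n)} [DecidableRel G.Adj]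
    {A : Finset (Fin n × Fin n × Fin n)} {pd p : Config n} (hp : p ∈ incorrectEquilibria G A pd)
    (v : Config n) : stressForm (coeffMatrix G A pd p) p v = 0 := by
  rw [coeffMatrix_eq_weightedMatrix, ← dotProduct_weakRigidityMatrix_mulVec hp.1,
    Matrix.dotProduct_mulVec, ← Matrix.mulVec_transpose, hp.2.1, zero_dotProduct]

theorem stressForm_weightedMatrix {n : ℕ} (G : SimpleGraph (Fin n)) [DecidableRel G.Adj]
    (A : Finset (Fin n × Fin n × Fin n)) (p : Config n) (l : Constraint G A → ℝ)
    (q v : Config n) : stressForm (weightedMatrix G A p l) q v =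
      ∑ s : G.edgeSet, 2 * l (Sum.inl s) * stressForm (symEdgeLap s.1) q v
        + ∑ a : A, l (Sum.inr a) * stressForm (angleCoeff p a.1) q v := by
  simp only [weightedMatrix, stressForm_add, stressForm_sum, stressForm_smul]

theorem stressForm_symEdgeLap_self {n : ℕ} (s : Sym2 (Fin n)) (p : Config n) :
    stressForm (symEdgeLap s) p p = sqLength p s := by
  induction s with
  | _ i j =>
    change stressForm (edgeLap i j) p p = ‖relPos p i j‖ ^ 2
    rw [stressForm_edgeLap, real_inner_self_eq_norm_sq]

/-- Euler's identity for the cosine of an angle, which is homogeneous of degree `0`. -/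
theorem stressForm_angleCoeff_self {n : ℕ} {p : Config n} {a : Fin n × Fin n × Fin n}
    (h1 : relPos p a.1 a.2.1 ≠ 0) (h2 : relPos p a.1 a.2.2 ≠ 0) :
    stressForm (angleCoeff p a) p p = 0 := by
  rw [stressForm_angleCoeff, ← relPos_sub_relPos p a.1 a.2.1 a.2.2]
  have hn1 := norm_ne_zero_iff.2 h1
  have hn2 := norm_ne_zero_iff.2 h2
  simp only [inner_sub_left, inner_sub_right, real_inner_self_eq_norm_sq, cosAngle]
  rw [real_inner_comm (relPos p a.1 a.2.1) (relPos p a.1 a.2.2)]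
  field_simp
  ring

/-! ### Collinear configurations and the sign of the form of `E` -/

/-- Collinear agents lie on a line with unit direction `u` and unit normal `m`. -/
theorem Collinear.exists_direction_normal {n : ℕ} {p : Config n}
    (h : Collinear ℝ (Set.range (agent p))) :
    ∃ (u m : EuclideanSpace ℝ (Fin 2)) (p₀ : EuclideanSpace ℝ (Fin 2)) (r : Fin n → ℝ),
      ‖u‖ = 1 ∧ ‖m‖ = 1 ∧ inner ℝ u m = 0 ∧ ∀ i, agent p i = p₀ + r i • u := by
  have hrot : ∀ u : EuclideanSpace ℝ (Fin 2), ‖u‖ = 1 →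
      ‖(!₂[-u 1, u 0] : EuclideanSpace ℝ (Fin 2))‖ = 1 ∧
        inner ℝ u (!₂[-u 1, u 0] : EuclideanSpace ℝ (Fin 2)) = 0 := by
    intro u hu
    constructor
    · rw [EuclideanSpace.norm_eq, Fin.sum_univ_two] at hu ⊢
      rw [← hu]
      simp [add_comm]
    · simp [PiLp.inner_apply, Fin.sum_univ_two]
      ring
  obtain ⟨p₀, v, hv⟩ := (collinear_iff_exists_forall_eq_smul_vadd _).1 h
  choose r hr using fun i => hv (agent p i) ⟨i, rfl⟩
  by_cases hv0 : v = 0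
  · have hu : ‖(EuclideanSpace.single 0 1 : EuclideanSpace ℝ (Fin 2))‖ = 1 := by simp
    refine ⟨_, _, p₀, 0, hu, (hrot _ hu).1, (hrot _ hu).2, fun i => ?_⟩
    rw [hr i, hv0]
    simp
  · have hu : ‖‖v‖⁻¹ • v‖ = 1 := norm_smul_inv_norm (𝕜 := ℝ) hv0
    refine ⟨_, _, p₀, fun i => r i * ‖v‖, hu, (hrot _ hu).1, (hrot _ hu).2, fun i => ?_⟩
    rw [hr i, smul_smul, mul_assoc, mul_inv_cancel₀ (norm_ne_zero_iff.2 hv0), mul_one, vadd_eq_add,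
      add_comm]

theorem relPos_eq_smul_of_agent_eq {n : ℕ} {p : Config n} {p₀ u : EuclideanSpace ℝ (Fin 2)}
    {r : Fin n → ℝ} (h : ∀ i, agent p i = p₀ + r i • u) (i j : Fin n) :
    relPos p i j = (r i - r j) • u := by
  rw [relPos, h i, h j, sub_smul]
  abel

/-- At a degenerate angle the form of `cos θ` is semidefinite. -/
theorem stressForm_angleCoeff_of_collinear {n : ℕ} {p : Config n} {a : Fin n × Fin n × Fin n}
    {u : EuclideanSpace ℝ (Fin 2)} (hu : ‖u‖ = 1) {b c : ℝ} (hb0 : b ≠ 0) (hc0 : c ≠ 0)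
    (hb : relPos p a.1 a.2.1 = b • u) (hc : relPos p a.1 a.2.2 = c • u) (q : Config n) :
    cosAngle p a * cosAngle p a = 1 ∧ stressForm (angleCoeff p a) q q =
      -(cosAngle p a * ‖b⁻¹ • relPos q a.1 a.2.1 - c⁻¹ • relPos q a.1 a.2.2‖ ^ 2) := by
  have hcos : cosAngle p a = b * c / (|b| * |c|) := by
    simp only [cosAngle, hb, hc, norm_smul, inner_smul_left, inner_smul_right,
      real_inner_self_eq_norm_sq, hu, Real.norm_eq_abs]
    simp [mul_comm]
  have hsq : (|b| * |c|) * (|b| * |c|) = (b * c) * (b * c) := by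
    rw [← abs_mul, abs_mul_abs_self]
  have hbc : |b| * |c| ≠ 0 := by positivity
  have hone : cosAngle p a * cosAngle p a = 1 := by
    rw [hcos, div_mul_div_comm, hsq, div_self (by positivity)]
  -- As the cosine is the sign of `b * c`, every coefficient becomes a multiple of the cosine and a
  -- perfect square remains.
  have hinv : 1 / (|b| * |c|) = cosAngle p a / (b * c) := by
    rw [hcos]
    field_simp
  refine ⟨hone, ?_⟩
  have hnb : ‖relPos p a.1 a.2.1‖ = |b| := by rw [hb, norm_smul, hu, mul_one, Real.norm_eq_abs]
  have hnc : ‖relPos p a.1 a.2.2‖ = |c| := by rw [hc, norm_smul, hu, mul_one, Real.norm_eq_abs]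
  rw [stressForm_angleCoeff, hnb, hnc, hinv, sq_abs, sq_abs,
    ← relPos_sub_relPos q a.1 a.2.1 a.2.2, ← real_inner_self_eq_norm_sq]
  simp only [inner_sub_left, inner_sub_right, inner_smul_left, inner_smul_right, conj_trivial]
  rw [real_inner_comm (relPos q a.1 a.2.1) (relPos q a.1 a.2.2)]
  field_simp
  ring

theorem collinear_range_agent_of_relPos_eq_smul {p : Config 3} {k i j : Fin 3} (hki : k ≠ i)
    (hkj : k ≠ j) (hij : i ≠ j) {r : ℝ} (h : relPos p k j = r • relPos p k i) :
    Collinear ℝ (Set.range (agent p)) := by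
  rw [collinear_iff_exists_forall_eq_smul_vadd]
  refine ⟨agent p k, relPos p k i, ?_⟩
  rintro _ ⟨l, rfl⟩
  have hl : l = k ∨ l = i ∨ l = j := by lia
  rcases hl with rfl | rfl | rfl
  · exact ⟨0, by simp⟩
  · exact ⟨-1, by simp [relPos]⟩
  · refine ⟨-r, ?_⟩
    rw [neg_smul, ← h]
    simp [relPos]

theorem cosAngle_eq_one {n : ℕ} {p : Config n} {a : Fin n × Fin n × Fin n}
    (h : relPos p a.1 a.2.1 ≠ 0) (hij : a.2.1 = a.2.2) : cosAngle p a = 1 := by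
  have hn := norm_ne_zero_iff.2 h
  rw [cosAngle, ← hij, real_inner_self_eq_norm_mul_norm, div_self (by positivity)]

/-- Equality in Cauchy–Schwarz would make the two arms of the angle parallel. -/
theorem abs_cosAngle_lt_one {p : Config 3} (hp : ¬ Collinear ℝ (Set.range (agent p)))
    {a : Fin 3 × Fin 3 × Fin 3} (hki : a.1 ≠ a.2.1) (hkj : a.1 ≠ a.2.2) (hij : a.2.1 ≠ a.2.2) :
    |cosAngle p a| < 1 := by
  refine (abs_real_inner_div_norm_mul_norm_le_one _ _).lt_of_ne fun h => hp ?_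
  obtain ⟨-, r, -, hr⟩ := (abs_real_inner_div_norm_mul_norm_eq_one_iff _ _).1 h
  exact collinear_range_agent_of_relPos_eq_smul hki hkj hij hr

/-- At a collinear incorrect equilibrium, the form of `E` is negative at the desired
configuration. -/
theorem stressForm_coeffMatrix_desired_neg {G : SimpleGraph (Fin 3)} [DecidableRel G.Adj]
    {A : Finset (Fin 3 × Fin 3 × Fin 3)} {pd p : Config 3}
    (hpdA : pd ∈ domainSet A) (hpd : ¬ Collinear ℝ (Set.range (agent pd)))
    (hp : p ∈ incorrectEquilibria G A pd)
    (hcol : Collinear ℝ (Set.range (agent p))) :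
    stressForm (coeffMatrix G A pd p) pd pd < 0 := by
  obtain ⟨u, m, p₀, r, hu, -, -, hr⟩ := hcol.exists_direction_normal
  have hrel := relPos_eq_smul_of_agent_eq hr
  have hcoef : ∀ a : A, r a.1.1 - r a.1.2.1 ≠ 0 ∧ r a.1.1 - r a.1.2.2 ≠ 0 := by
    intro a
    have h := relPos_ne_zero_of_mem_domainSet hp.1 a.2
    rw [hrel, hrel, smul_ne_zero_iff, smul_ne_zero_iff] at h
    exact ⟨h.1.1, h.2.1⟩
  set e := errorVec G A pd p with he
  have hterm : ∀ a : A, e (Sum.inr a) * stressForm (angleCoeff p a.1) pd pd ≤ 0 ∧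
      (e (Sum.inr a) ≠ 0 → e (Sum.inr a) * stressForm (angleCoeff p a.1) pd pd < 0) := by
    intro a
    obtain ⟨hone, hform⟩ := stressForm_angleCoeff_of_collinear hu (hcoef a).1 (hcoef a).2
      (hrel _ _) (hrel _ _) pd
    -- Since `cos² = 1` at `p`, multiplying the error by `cos θ` gives `1 - cos θ cos θ*`.
    have hmul : e (Sum.inr a) * stressForm (angleCoeff p a.1) pd pd =
        -((1 - cosAngle p a.1 * cosAngle pd a.1) * ‖(r a.1.1 - r a.1.2.1)⁻¹ • relPos pd a.1.1 a.1.2.1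
          - (r a.1.1 - r a.1.2.2)⁻¹ • relPos pd a.1.1 a.1.2.2‖ ^ 2) := by
      rw [hform, ← hone]
      simp only [he, errorVec, weakRigidityFun]
      ring
    have habs : |cosAngle p a.1| = 1 := by
      rcases mul_self_eq_one_iff.1 hone with h | h <;> simp [h]
    have hle : cosAngle p a.1 * cosAngle pd a.1 ≤ |cosAngle pd a.1| := by
      refine (le_abs_self _).trans ?_
      rw [abs_mul, habs, one_mul]
    have hle1 : |cosAngle pd a.1| ≤ 1 := abs_real_inner_div_norm_mul_norm_le_one _ _
    rw [hmul]
    refine ⟨neg_nonpos.2 (mul_nonneg (by linarith) (sq_nonneg _)), fun hne => ?_⟩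
    have hki : a.1.1 ≠ a.1.2.1 := fun h => (hcoef a).1 (by rw [h, sub_self])
    have hkj : a.1.1 ≠ a.1.2.2 := fun h => (hcoef a).2 (by rw [h, sub_self])
    -- A triple with coinciding arms has cosine `1` in both configurations, so its error would
    -- vanish.
    have hij : a.1.2.1 ≠ a.1.2.2 := by
      intro h
      apply hne
      simp only [he, errorVec, weakRigidityFun]
      rw [cosAngle_eq_one (relPos_ne_zero_of_mem_domainSet hp.1 a.2).1 h,
        cosAngle_eq_one (relPos_ne_zero_of_mem_domainSet hpdA a.2).1 h, sub_self]
    have hlt := abs_cosAngle_lt_one hpd hki hkj hij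
    -- If the square vanished, the two arms of the angle in the desired configuration would be
    -- parallel.
    refine neg_neg_of_pos (mul_pos (by linarith) (pow_pos (norm_pos_iff.2 fun h0 => hpd ?_) 2))
    refine collinear_range_agent_of_relPos_eq_smul hki hkj hij
      (r := (r a.1.1 - r a.1.2.2) * (r a.1.1 - r a.1.2.1)⁻¹) ?_
    rw [mul_smul, sub_eq_zero.1 h0, smul_inv_smul₀ (hcoef a).2]
  have hself := stressForm_coeffMatrix_eq_zero hp p
  rw [coeffMatrix_eq_weightedMatrix, stressForm_weightedMatrix] at hself ⊢
  have hzero : ∑ a : A, e (Sum.inr a) * stressForm (angleCoeff p a.1) p p = 0 :=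
    Finset.sum_eq_zero fun a _ => by
      rw [stressForm_angleCoeff_self (relPos_ne_zero_of_mem_domainSet hp.1 a.2).1
        (relPos_ne_zero_of_mem_domainSet hp.1 a.2).2, mul_zero]
  simp only [stressForm_symEdgeLap_self] at hself ⊢
  rw [hzero, add_zero] at hself
  -- The equilibrium relation `∑ 2 e ‖z‖² = 0` is subtracted, replacing each desired squared length
  -- by minus the error.
  have hedge : ∑ s : G.edgeSet, 2 * e (Sum.inl s) * sqLength pd s.1
      = ∑ s : G.edgeSet, -(2 * e (Sum.inl s) ^ 2) := by
    rw [← sub_zero (∑ s : G.edgeSet, 2 * e (Sum.inl s) * sqLength pd s.1), ← hself,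
      ← Finset.sum_sub_distrib]
    refine Finset.sum_congr rfl fun s _ => ?_
    simp only [he, errorVec, weakRigidityFun]
    ring
  rw [hedge]
  have hle1 : ∀ s ∈ Finset.univ, -(2 * e (Sum.inl (s : G.edgeSet)) ^ 2) ≤ 0 := fun s _ => by
    nlinarith [sq_nonneg (e (Sum.inl s))]
  have hle2 : ∀ a ∈ Finset.univ, e (Sum.inr (a : A)) * stressForm (angleCoeff p a.1) pd pd ≤ 0 :=
    fun a _ => (hterm a).1
  obtain ⟨c, hc⟩ := Function.ne_iff.1 hp.2.2
  rcases c with s | a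
  · refine add_neg_of_neg_of_nonpos (Finset.sum_neg' hle1 ⟨s, Finset.mem_univ _, ?_⟩)
      (Finset.sum_nonpos hle2)
    have : 0 < e (Sum.inl s) ^ 2 := by
      have h0 : e (Sum.inl s) ≠ 0 := hc
      positivity
    linarith
  · exact add_neg_of_nonpos_of_neg (Finset.sum_nonpos hle1)
      (Finset.sum_neg' hle2 ⟨a, Finset.mem_univ _, (hterm a).2 hc⟩)

/-! ### Curvature of the potential normal to a line -/

/-- The configuration-space velocity `w ⊗ m`. -/
noncomputable def tensorMotion {n : ℕ} (w : Fin n → ℝ) (m : EuclideanSpace ℝ (Fin 2)) : Config n :=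
  WithLp.toLp 2 fun x => w x.1 * m x.2

theorem relPos_tensorMotion {n : ℕ} (w : Fin n → ℝ) (m : EuclideanSpace ℝ (Fin 2)) (i j : Fin n) :
    relPos (tensorMotion w m) i j = (w i - w j) • m := by
  ext a
  simp only [relPos, agent, tensorMotion, PiLp.sub_apply, PiLp.smul_apply, smul_eq_mul]
  ring

theorem stressForm_tensorMotion {n : ℕ} (M : Matrix (Fin n) (Fin n) ℝ) (w : Fin n → ℝ)
    {m : EuclideanSpace ℝ (Fin 2)} (hm : ‖m‖ = 1) :
    stressForm M (tensorMotion w m) (tensorMotion w m) = w ⬝ᵥ M.mulVec w := by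
  have h : ∀ a, (fun i => tensorMotion w m (i, a)) = m a • w := fun a => by
    ext i
    simp [tensorMotion, mul_comm]
  have hm2 : ∑ a, m a * m a = 1 := by
    have := real_inner_self_eq_norm_sq m
    rw [hm, PiLp.inner_apply] at this
    simpa [← sq] using this
  simp only [stressForm, h, Matrix.mulVec_smul, dotProduct_smul, smul_dotProduct, smul_eq_mul,
    ← mul_assoc]
  rw [← Finset.sum_mul, hm2, one_mul]

/-- The second derivative of the potential in a direction normal to a degenerate configuration. -/
theorem fderiv_fderiv_errorPotential_of_normal {n : ℕ} {G : SimpleGraph (Fin n)}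
    [DecidableRel G.Adj] {A : Finset (Fin n × Fin n × Fin n)} (pd : Config n) {p : Config n}
    (hp : p ∈ domainSet A) {v : Config n}
    (hv : ∀ i j k l, inner ℝ (relPos p i j) (relPos v k l) = 0) :
    fderiv ℝ (fderiv ℝ (errorPotential G A pd)) p v v = stressForm (coeffMatrix G A pd p) v v := by
  have hnorm : ∀ i j (s : ℝ),
      ‖relPos (p + s • v) i j‖ ^ 2 = ‖relPos p i j‖ ^ 2 + s ^ 2 * ‖relPos v i j‖ ^ 2 := by
    intro i j s
    rw [relPos_add_smul, norm_add_sq_real, inner_smul_right, hv, norm_smul, mul_pow,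
      Real.norm_eq_abs, sq_abs]
    ring
  -- By orthogonality no constraint has a term linear in `s`; `g` expresses each one through `τ =
  -- s²`, with norms as square roots of affine functions.
  let g : Constraint G A → ℝ → ℝ := fun c τ => match c with
    | Sum.inl s => sqLength p s.1 + τ * sqLength v s.1
    | Sum.inr a => (inner ℝ (relPos p a.1.1 a.1.2.1) (relPos p a.1.1 a.1.2.2)
          + τ * inner ℝ (relPos v a.1.1 a.1.2.1) (relPos v a.1.1 a.1.2.2)) /
        (√(‖relPos p a.1.1 a.1.2.1‖ ^ 2 + τ * ‖relPos v a.1.1 a.1.2.1‖ ^ 2)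
          * √(‖relPos p a.1.1 a.1.2.2‖ ^ 2 + τ * ‖relPos v a.1.1 a.1.2.2‖ ^ 2))
  let g' : Constraint G A → ℝ := fun c => match c with
    | Sum.inl s => stressForm (symEdgeLap s.1) v v
    | Sum.inr a => stressForm (angleCoeff p a.1) v v / 2
  have hg0 : ∀ c, g c 0 = weakRigidityFun G A p c := by
    rintro (s | a)
    · simp [g, weakRigidityFun]
    · simp [g, weakRigidityFun, cosAngle]
  have hgs : ∀ c (s : ℝ), weakRigidityFun G A (p + s • v) c = g c (s ^ 2) := by
    rintro (⟨e, he⟩ | a) s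
    · change sqLength (p + s • v) e = sqLength p e + s ^ 2 * sqLength v e
      induction e with
      | _ i j => exact hnorm i j s
    · simp only [g, weakRigidityFun, cosAngle, ← hnorm, Real.sqrt_sq (norm_nonneg _)]
      congr 1
      rw [relPos_add_smul, relPos_add_smul, inner_add_left, inner_add_right, inner_add_right,
        inner_smul_left, inner_smul_right, inner_smul_left, inner_smul_right, hv,
        real_inner_comm (relPos p a.1.1 a.1.2.2) (relPos v a.1.1 a.1.2.1), hv]
      simp
      ring
  have hgc : ∀ c, ContDiffAt ℝ 1 (g c) 0 ∧ HasDerivAt (g c) (g' c) 0 := by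
    rintro (s | a)
    · refine ⟨contDiffAt_const.add (contDiffAt_id.mul contDiffAt_const), ?_⟩
      refine (((hasDerivAt_id (0 : ℝ)).mul_const (sqLength v s.1)).const_add _).congr_deriv ?_
      simp [g', stressForm_symEdgeLap_self]
    · obtain ⟨h1, h2⟩ := relPos_ne_zero_of_mem_domainSet hp a.2
      have hn1 := norm_ne_zero_iff.2 h1
      have hn2 := norm_ne_zero_iff.2 h2
      have haff : ∀ b c : ℝ, ContDiffAt ℝ 1 (fun τ : ℝ => b + τ * c) 0 := fun b c =>
        contDiffAt_const.add (contDiffAt_id.mul contDiffAt_const)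
      have haffd : ∀ b c : ℝ, HasDerivAt (fun τ : ℝ => b + τ * c) c 0 := fun b c => by
        simpa using ((hasDerivAt_id (0 : ℝ)).mul_const c).const_add b
      constructor
      · refine (haff _ _).div (((haff _ _).sqrt ?_).mul ((haff _ _).sqrt ?_)) ?_
        · simpa using h1
        · simpa using h2
        · simpa using ⟨h1, h2⟩
      · refine ((haffd _ _).div (((haffd _ _).sqrt ?_).mul ((haffd _ _).sqrt ?_))
          ?_).congr_deriv ?_
        · simpa using h1
        · simpa using h2
        · simpa using ⟨h1, h2⟩
        · simp only [zero_mul, add_zero, Pi.mul_apply, Real.sqrt_sq (norm_nonneg _), g']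
          rw [stressForm_angleCoeff, ← relPos_sub_relPos v a.1.1 a.1.2.1 a.1.2.2]
          simp only [inner_sub_left, inner_sub_right, real_inner_self_eq_norm_sq, cosAngle]
          rw [real_inner_comm (relPos v a.1.1 a.1.2.1) (relPos v a.1.1 a.1.2.2)]
          field_simp
          ring
  have hh : ContDiffAt ℝ 1 (fun τ => ∑ c, (g c τ - weakRigidityFun G A pd c) ^ 2 / 2) 0 :=
    ContDiffAt.sum fun c _ => (((hgc c).1.sub contDiffAt_const).pow 2).div_const 2
  have hd : HasDerivAt (fun τ => ∑ c, (g c τ - weakRigidityFun G A pd c) ^ 2 / 2)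
      (∑ c, errorVec G A pd p c * g' c) 0 := by
    refine HasDerivAt.fun_sum fun c _ => ?_
    refine ((((hgc c).2.sub_const _).pow 2).div_const 2).congr_deriv ?_
    rw [hg0]
    simp [errorVec]
    ring
  rw [fderiv_fderiv_apply_self_of_eq_comp_sq (contDiffAt_errorPotential pd hp) hh
    (Eventually.of_forall fun s => by simp only [errorPotential, errorVec, hgs]), hd.deriv,
    coeffMatrix_eq_weightedMatrix, stressForm_weightedMatrix, Fintype.sum_sum_type, mul_add,
    Finset.mul_sum, Finset.mul_sum]
  congr 1 <;> refine Finset.sum_congr rfl fun c _ => ?_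
  · simp only [g']
    ring
  · simp only [g']
    ring

/-! ### Consequences of rigidity and minimality -/

theorem mulVec_weakRigidityMatrix_eq_zero_iff {n : ℕ} {G : SimpleGraph (Fin n)}
    {A : Finset (Fin n × Fin n × Fin n)} {p : Config n} (hp : p ∈ domainSet A) (v : Config n) :
    (weakRigidityMatrix G A p).mulVec v.ofLp = 0 ↔
      (∀ s ∈ G.edgeSet, stressForm (symEdgeLap s) p v = 0) ∧
        ∀ a ∈ A, stressForm (angleCoeff p a) p v = 0 := by
  rw [funext_iff]
  simp only [weakRigidityMatrix_mulVec, Pi.zero_apply]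
  rw [Sum.forall]
  simp only [weakRigidityFun, fderiv_sqLength, Subtype.forall, mul_eq_zero, OfNat.ofNat_ne_zero,
    false_or]
  refine and_congr Iff.rfl (forall₂_congr fun a ha => ?_)
  rw [fderiv_cosAngle (relPos_ne_zero_of_mem_domainSet hp ha).1
    (relPos_ne_zero_of_mem_domainSet hp ha).2]

theorem domainSet_anti {n : ℕ} {A B : Finset (Fin n × Fin n × Fin n)} (h : B ⊆ A) :
    domainSet A ⊆ domainSet B := fun _ hp a ha => hp a (h ha)

theorem stressForm_symEdgeLap_eq_zero_of_normal {n : ℕ} {p v : Config n}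
    (hv : ∀ i j k l, inner ℝ (relPos p i j) (relPos v k l) = 0) (s : Sym2 (Fin n)) :
    stressForm (symEdgeLap s) p v = 0 := by
  induction s with
  | _ i j => exact (stressForm_edgeLap i j p v).trans (hv _ _ _ _)

theorem stressForm_angleCoeff_eq_zero_of_normal {n : ℕ} {p v : Config n}
    (hv : ∀ i j k l, inner ℝ (relPos p i j) (relPos v k l) = 0) (a : Fin n × Fin n × Fin n) :
    stressForm (angleCoeff p a) p v = 0 := by
  simp [stressForm_angleCoeff, hv]

theorem inner_relPos_tensorMotion_of_normal {n : ℕ} {p : Config n}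
    {p₀ u m : EuclideanSpace ℝ (Fin 2)} {r : Fin n → ℝ} (h : ∀ i, agent p i = p₀ + r i • u)
    (hum : inner ℝ u m = 0) (w : Fin n → ℝ) (i j k l : Fin n) :
    inner ℝ (relPos p i j) (relPos (tensorMotion w m) k l) = 0 := by
  rw [relPos_eq_smul_of_agent_eq h, relPos_tensorMotion, inner_smul_left, inner_smul_right, hum]
  simp

/-- A trivial motion of a collinear configuration has normal components that are affine in the
position along the line. -/
theorem IsTrivialMotion.affine_of_normal {n : ℕ} {c : Prop} {p : Config n}
    {p₀ u m : EuclideanSpace ℝ (Fin 2)} {r : Fin n → ℝ} (hm : ‖m‖ = 1)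
    (h : ∀ i, agent p i = p₀ + r i • u) (hum : inner ℝ u m = 0) {w : Fin n → ℝ}
    (ht : IsTrivialMotion c p (tensorMotion w m)) : ∃ α β : ℝ, ∀ i, w i = α + β * r i := by
  obtain ⟨b, ω, d, -, hbv⟩ := ht
  have hm2 : m 0 * m 0 + m 1 * m 1 = 1 := by
    have := real_inner_self_eq_norm_sq m
    rw [hm, PiLp.inner_apply, Fin.sum_univ_two] at this
    simpa [← sq] using this
  have hum2 : u 0 * m 0 + u 1 * m 1 = 0 := by
    rw [PiLp.inner_apply, Fin.sum_univ_two] at hum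
    simpa [mul_comm] using hum
  refine ⟨(b 0 - ω * p₀ 1 + d * p₀ 0) * m 0 + (b 1 + ω * p₀ 0 + d * p₀ 1) * m 1,
    ω * (u 0 * m 1 - u 1 * m 0), fun i => ?_⟩
  obtain ⟨h0, h1⟩ := hbv i
  have hp0 : p (i, 0) = p₀ 0 + r i * u 0 := by
    simpa [agent] using congrArg (fun x : EuclideanSpace ℝ (Fin 2) => x 0) (h i)
  have hp1 : p (i, 1) = p₀ 1 + r i * u 1 := by
    simpa [agent] using congrArg (fun x : EuclideanSpace ℝ (Fin 2) => x 1) (h i)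
  simp only [tensorMotion] at h0 h1
  rw [hp0, hp1] at h0 h1
  have hw : w i = (w i * m 0) * m 0 + (w i * m 1) * m 1 := by
    linear_combination (-w i) * hm2
  rw [hw, h0, h1]
  linear_combination (d * r i) * hum2

/-- At a collinear configuration all `w ⊗ m` with `m` normal are infinitesimal motions. These form a
three-dimensional family, whereas trivial ones have `w` affine in the position on the line, at most
two parameters. -/
theorem IsGIWR.not_collinear {G : SimpleGraph (Fin 3)} {A : Finset (Fin 3 × Fin 3 × Fin 3)}
    {p : Config 3} (h : IsGIWR G A p) : ¬ Collinear ℝ (Set.range (agent p)) := by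
  intro hcol
  obtain ⟨u, m, p₀, r, -, hm, hum, hr⟩ := hcol.exists_direction_normal
  have haff : ∀ w : Fin 3 → ℝ, ∃ α β : ℝ, ∀ i, w i = α + β * r i := by
    intro w
    refine IsTrivialMotion.affine_of_normal hm hr hum (h.2 (tensorMotion w m) ?_)
    rw [mulVec_weakRigidityMatrix_eq_zero_iff h.1]
    have hperp := inner_relPos_tensorMotion_of_normal hr hum w
    exact ⟨fun s _ => stressForm_symEdgeLap_eq_zero_of_normal hperp s,
      fun a _ => stressForm_angleCoeff_eq_zero_of_normal hperp a⟩
  -- This `w` is orthogonal to both `1` and `r`; being affine in `r`, it must be zero.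
  obtain ⟨α, β, h1⟩ := haff ![r 1 - r 2, r 2 - r 0, r 0 - r 1]
  have h10 : r 1 - r 2 = α + β * r 0 := h1 0
  have h11 : r 2 - r 0 = α + β * r 1 := h1 1
  have h12 : r 0 - r 1 = α + β * r 2 := h1 2
  have hsum : (r 1 - r 2) ^ 2 + (r 2 - r 0) ^ 2 + (r 0 - r 1) ^ 2 = 0 := by
    linear_combination (r 1 - r 2) * h10 + (r 2 - r 0) * h11 + (r 0 - r 1) * h12
  have h01 : r 0 = r 1 := by nlinarith [sq_nonneg (r 1 - r 2), sq_nonneg (r 2 - r 0)]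
  obtain ⟨α, β, h2⟩ := haff ![1, 0, 0]
  have h20 : (1 : ℝ) = α + β * r 0 := h2 0
  have h21 : (0 : ℝ) = α + β * r 1 := h2 1
  rw [h01] at h20
  linarith

/-- The rows of the weak rigidity matrix of a minimally rigid framework are independent. -/
theorem IsMinimallyGIWR.weight_eq_zero {n : ℕ} {G : SimpleGraph (Fin n)} [DecidableRel G.Adj]
    {A : Finset (Fin n × Fin n × Fin n)} {p : Config n} (h : IsMinimallyGIWR G A p)
    {l : Constraint G A → ℝ} (hl : weightedMatrix G A p l = 0) : l = 0 := by
  have hsum : ∀ v, ∑ s : G.edgeSet, 2 * l (Sum.inl s) * stressForm (symEdgeLap s.1) p v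
        + ∑ a : A, l (Sum.inr a) * stressForm (angleCoeff p a.1) p v = 0 := fun v => by
    rw [← stressForm_weightedMatrix, hl, stressForm_zero]
  by_contra hne
  obtain ⟨c, hc⟩ := Function.ne_iff.1 hne
  rw [Pi.zero_apply] at hc
  rcases c with s | a
  · refine h.2.1 s.1 s.2 fun v hv => h.1.2 v ?_
    rw [mulVec_weakRigidityMatrix_eq_zero_iff h.1.1] at hv ⊢
    have hother : ∀ t ∈ G.edgeSet, t ≠ s.1 → stressForm (symEdgeLap t) p v = 0 := fun t ht hts =>
      hv.1 t (by
        rw [SimpleGraph.edgeSet_deleteEdges]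
        exact ⟨ht, hts⟩)
    -- All other terms of the relation vanish at `v`, so the removed row with nonzero weight
    -- annihilates `v` too: its removal would not have lost rigidity.
    have h1 := hsum v
    rw [Finset.sum_eq_single s (fun t _ ht => by
        rw [hother t.1 t.2 fun he => ht (Subtype.ext he), mul_zero]) (by simp),
      Finset.sum_eq_zero (fun a _ => by rw [hv.2 a.1 a.2, mul_zero]), add_zero] at h1
    refine ⟨fun t ht => ?_, hv.2⟩
    by_cases hts : t = s.1
    · rw [hts]
      exact (mul_eq_zero.1 h1).resolve_left (mul_ne_zero two_ne_zero hc)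
    · exact hother t ht hts
  · refine h.2.2 a.1 a.2 fun v hv => h.1.2 v ?_
    rw [mulVec_weakRigidityMatrix_eq_zero_iff h.1.1]
    rw [mulVec_weakRigidityMatrix_eq_zero_iff
      (domainSet_anti (Finset.erase_subset _ _) h.1.1)] at hv
    have hother : ∀ b ∈ A, b ≠ a.1 → stressForm (angleCoeff p b) p v = 0 := fun b hb hba =>
      hv.2 b (Finset.mem_erase.2 ⟨hba, hb⟩)
    have h1 := hsum v
    rw [Finset.sum_eq_single a (fun b _ hb => by
        rw [hother b.1 b.2 fun he => hb (Subtype.ext he), mul_zero]) (by simp),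
      Finset.sum_eq_zero (fun s _ => by rw [hv.1 s.1 s.2, mul_zero]), zero_add] at h1
    refine ⟨hv.1, fun b hb => ?_⟩
    by_cases hba : b = a.1
    · rw [hba]
      exact (mul_eq_zero.1 h1).resolve_left hc
    · exact hother b hb hba

theorem edgeLap_apply_of_ne {n : ℕ} {i j : Fin n} (h : i ≠ j) : edgeLap i j i j = -1 := by
  simp [edgeLap, Matrix.vecMulVec_apply, h, h.symm]

theorem edgeLap_apply_eq_zero {n : ℕ} {i j x y : Fin n} (hxy : x ≠ y)
    (h : s(i, j) ≠ s(x, y)) : edgeLap i j x y = 0 := by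
  have h' : ¬ ((i = x ∧ j = y) ∨ (i = y ∧ j = x)) := fun hh => h (Sym2.eq_iff.2 hh)
  simp only [edgeLap, Matrix.vecMulVec_apply, Pi.sub_apply, Pi.single_apply]
  grind

theorem symEdgeLap_apply {n : ℕ} (s : Sym2 (Fin n)) {x y : Fin n} (hxy : x ≠ y) :
    symEdgeLap s x y = if s = s(x, y) then -1 else 0 := by
  split_ifs with h
  · rw [h]
    exact edgeLap_apply_of_ne hxy
  · induction s with
    | _ i j => exact edgeLap_apply_eq_zero hxy h

theorem edgeLap_mulVec_one {n : ℕ} (i j : Fin n) : (edgeLap i j).mulVec 1 = 0 := by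
  rw [edgeLap, Matrix.vecMulVec_mulVec]
  simp [sub_dotProduct]

theorem weightedMatrix_mulVec_one {n : ℕ} (G : SimpleGraph (Fin n)) [DecidableRel G.Adj]
    (A : Finset (Fin n × Fin n × Fin n)) (p : Config n) (l : Constraint G A → ℝ) :
    (weightedMatrix G A p l).mulVec 1 = 0 := by
  have hs : ∀ s : Sym2 (Fin n), (symEdgeLap s).mulVec 1 = 0 := fun s => by
    induction s with
    | _ i j => exact edgeLap_mulVec_one i j
  have ha : ∀ a, (angleCoeff p a).mulVec 1 = 0 := fun a => by
    simp [angleCoeff, Matrix.sub_mulVec, Matrix.add_mulVec, Matrix.smul_mulVec,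
      edgeLap_mulVec_one]
  simp [weightedMatrix, Matrix.add_mulVec, Matrix.sum_mulVec, Matrix.smul_mulVec, hs, ha]

/-- Zero row sums recover the diagonal, so such matrices form a space of dimension three; this is
the source of the bound on the number of constraints. -/
theorem Matrix.eq_zero_of_isHermitian_of_mulVec_one {M : Matrix (Fin 3) (Fin 3) ℝ}
    (hM : M.IsHermitian) (h1 : M.mulVec 1 = 0) (h01 : M 0 1 = 0) (h02 : M 0 2 = 0)
    (h12 : M 1 2 = 0) : M = 0 := by
  have hs : ∀ i j, M i j = M j i := fun i j => by simpa using hM.apply j i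
  have hrow : ∀ i, M i 0 + M i 1 + M i 2 = 0 := fun i => by
    have := congrFun h1 i
    simpa [Matrix.mulVec, dotProduct, Fin.sum_univ_three] using this
  have h0 := hrow 0
  have h1 := hrow 1
  have h2 := hrow 2
  have h10 := hs 1 0
  have h20 := hs 2 0
  have h21 := hs 2 1
  ext i j
  fin_cases i <;> fin_cases j <;> simp <;> linarith

/-- A minimally rigid framework of three agents has at most three constraints. -/
theorem IsMinimallyGIWR.card_le {G : SimpleGraph (Fin 3)} [DecidableRel G.Adj]
    {A : Finset (Fin 3 × Fin 3 × Fin 3)} {p : Config 3} (h : IsMinimallyGIWR G A p) :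
    G.edgeFinset.card + A.card ≤ 3 := by
  let f : (Constraint G A → ℝ) →ₗ[ℝ] (Fin 3 → ℝ) :=
    { toFun := fun l => ![weightedMatrix G A p l 0 1, weightedMatrix G A p l 0 2,
        weightedMatrix G A p l 1 2]
      map_add' := fun l l' => by
        have : weightedMatrix G A p (l + l') = weightedMatrix G A p l + weightedMatrix G A p l' := by
          simp only [weightedMatrix, Pi.add_apply, mul_add, add_smul, Finset.sum_add_distrib]
          abel
        simp [this]
      map_smul' := fun c l => by
        have : weightedMatrix G A p (c • l) = c • weightedMatrix G A p l := by
          simp only [weightedMatrix, Pi.smul_apply, smul_add, Finset.smul_sum, smul_smul,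
            smul_eq_mul]
          congr 1
          exact Finset.sum_congr rfl fun _ _ => by ring_nf
        simp [this] }
  have hinj : Function.Injective f := by
    rw [← LinearMap.ker_eq_bot, LinearMap.ker_eq_bot']
    intro l hl
    refine h.weight_eq_zero (Matrix.eq_zero_of_isHermitian_of_mulVec_one
      (isHermitian_weightedMatrix G A p l) (weightedMatrix_mulVec_one G A p l)
      (congrFun hl 0) (congrFun hl 1) (congrFun hl 2))
  have hfin := LinearMap.finrank_le_finrank_of_injective hinj
  rw [Module.finrank_fintype_fun_eq_card, Module.finrank_fintype_fun_eq_card, Fintype.card_sum,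
    Fintype.card_coe, Fintype.card_fin] at hfin
  rwa [SimpleGraph.edgeFinset_card]

/-! ### Entries of weighted matrices and stresses of a triangle -/

/-- The weight of the edge `ij`, read as `0` where there is no such edge. -/
noncomputable def edgeWeight {n : ℕ} {G : SimpleGraph (Fin n)} [DecidableRel G.Adj]
    {A : Finset (Fin n × Fin n × Fin n)} (l : Constraint G A → ℝ) (i j : Fin n) : ℝ :=
  if h : G.Adj i j then l (Sum.inl ⟨s(i, j), h⟩) else 0

theorem edgeWeight_of_not_adj {n : ℕ} {G : SimpleGraph (Fin n)} [DecidableRel G.Adj]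
    {A : Finset (Fin n × Fin n × Fin n)} (l : Constraint G A → ℝ) {i j : Fin n}
    (h : ¬ G.Adj i j) : edgeWeight l i j = 0 := dif_neg h

theorem weightedMatrix_apply {n : ℕ} (G : SimpleGraph (Fin n)) [DecidableRel G.Adj]
    (A : Finset (Fin n × Fin n × Fin n)) (p : Config n) (l : Constraint G A → ℝ) {i j : Fin n}
    (hij : i ≠ j) : weightedMatrix G A p l i j =
      -2 * edgeWeight l i j + ∑ a : A, l (Sum.inr a) * angleCoeff p a.1 i j := by
  rw [weightedMatrix, Matrix.add_apply, Matrix.sum_apply, Matrix.sum_apply]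
  simp only [Matrix.smul_apply, smul_eq_mul, symEdgeLap_apply _ hij]
  congr 1
  by_cases h : G.Adj i j
  · rw [Finset.sum_eq_single (⟨s(i, j), h⟩ : G.edgeSet) (fun s _ hs => by
      rw [if_neg fun he => hs (Subtype.ext he), mul_zero]) (by simp), if_pos rfl, edgeWeight,
      dif_pos h]
    ring
  · rw [edgeWeight_of_not_adj l h, mul_zero]
    refine Finset.sum_eq_zero fun s _ => ?_
    rw [if_neg, mul_zero]
    intro he
    exact h ((SimpleGraph.mem_edgeSet G).1 (he ▸ s.2))

theorem weight_inl_eq_zero {n : ℕ} {G : SimpleGraph (Fin n)} [DecidableRel G.Adj]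
    {A : Finset (Fin n × Fin n × Fin n)} {l : Constraint G A → ℝ}
    (h : ∀ i j, i ≠ j → edgeWeight l i j = 0) (s : G.edgeSet) : l (Sum.inl s) = 0 := by
  obtain ⟨s, hs⟩ := s
  induction s with
  | _ i j =>
    have hadj : G.Adj i j := hs
    have := h i j hadj.ne
    rwa [edgeWeight, dif_pos hadj] at this

theorem edgeWeight_comm {n : ℕ} {G : SimpleGraph (Fin n)} [DecidableRel G.Adj]
    {A : Finset (Fin n × Fin n × Fin n)} (l : Constraint G A → ℝ) (i j : Fin n) :
    edgeWeight l i j = edgeWeight l j i := by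
  simp only [edgeWeight, G.adj_comm i j, Sym2.eq_swap (a := i) (b := j)]

/-- An equilibrium stress of a noncollinear triangle vanishes. -/
theorem eq_zero_of_stressForm_eq_zero {M : Matrix (Fin 3) (Fin 3) ℝ} (hM : M.IsHermitian)
    (h1 : M.mulVec 1 = 0) {p : Config 3} (hp : ¬ Collinear ℝ (Set.range (agent p)))
    (h : ∀ v, stressForm M p v = 0) : M = 0 := by
  have hs : ∀ i j, M i j = M j i := fun i j => by simpa using hM.apply j i
  have hrow : ∀ i, M i 0 + M i 1 + M i 2 = 0 := fun i => by
    have := congrFun h1 i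
    simpa [Matrix.mulVec, dotProduct, Fin.sum_univ_three] using this
  -- Testing against the velocity that moves only coordinate `a` of agent `i` isolates row `i` of
  -- `M`.
  have heq : ∀ i a, M i 0 * p (0, a) + M i 1 * p (1, a) + M i 2 * p (2, a) = 0 := by
    intro i a
    have h2 : ∀ b, (fun k => (EuclideanSpace.single (i, a) (1 : ℝ) : Config 3) (k, b))
        = if b = a then Pi.single i 1 else 0 := by
      intro b
      ext k
      by_cases hb : b = a <;> by_cases hk : k = i <;> simp [hb, hk]
    have h3 := h (EuclideanSpace.single (i, a) 1)
    simp only [stressForm, h2] at h3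
    rw [Finset.sum_eq_single a (fun b _ hb => by simp [hb]) (by simp), if_pos rfl] at h3
    rw [Matrix.mulVec_single_one] at h3
    simp only [dotProduct, Fin.sum_univ_three, Matrix.col_apply] at h3
    rw [hs 0 i, hs 1 i, hs 2 i] at h3
    linarith
  -- With zero row sums, row `k` reads `M k i z_ki + M k j z_kj = 0`; a nonzero `M k j` would make
  -- the two sides at `k` parallel.
  have hoff : ∀ k i j : Fin 3, k ≠ i → k ≠ j → i ≠ j → M k j = 0 := by
    intro k i j hki hkj hij
    by_contra hne
    have huniv : ∀ f : Fin 3 → ℝ, f 0 + f 1 + f 2 = f k + f i + f j := by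
      intro f
      rw [← Fin.sum_univ_three]
      have : (Finset.univ : Finset (Fin 3)) = {k, i, j} := by
        ext x
        simp only [Finset.mem_univ, Finset.mem_insert, Finset.mem_singleton, true_iff]
        lia
      rw [this, Finset.sum_insert (by simp [hki, hkj]), Finset.sum_insert (by simp [hij]),
        Finset.sum_singleton, add_assoc]
    refine hp (collinear_range_agent_of_relPos_eq_smul hki hkj hij (r := -(M k i / M k j)) ?_)
    ext a
    have h2 := heq k a
    have h3 := hrow k
    rw [huniv fun x => M k x] at h3
    rw [huniv fun x => M k x * p (x, a)] at h2
    simp only [relPos, agent, PiLp.sub_apply, PiLp.smul_apply, smul_eq_mul]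
    field_simp
    linear_combination p (k, a) * h3 - h2
  exact Matrix.eq_zero_of_isHermitian_of_mulVec_one hM h1
    (hoff 0 2 1 (by decide) (by decide) (by decide)) (hoff 0 1 2 (by decide) (by decide) (by decide))
    (hoff 1 0 2 (by decide) (by decide) (by decide))

/-! ### Matrices of the angle constraints in a triangle -/

theorem angleCoeff_swap {n : ℕ} (p : Config n) (k i j : Fin n) :
    angleCoeff p (k, i, j) = angleCoeff p (k, j, i) := by
  have hc : cosAngle p (k, i, j) = cosAngle p (k, j, i) := by
    simp only [cosAngle]
    rw [real_inner_comm, mul_comm]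
  simp only [angleCoeff, hc, mul_comm ‖relPos p k i‖, edgeLap_comm i j]
  abel

/-- At a noncollinear configuration this entry is positive, so a dependency involving a single angle
must involve the opposite edge. -/
theorem angleCoeff_apply_opposite {n : ℕ} (p : Config n) {k i j : Fin n} (hki : k ≠ i)
    (hkj : k ≠ j) (hij : i ≠ j) :
    angleCoeff p (k, i, j) i j = 1 / (‖relPos p k i‖ * ‖relPos p k j‖) := by
  simp only [angleCoeff, Matrix.sub_apply, Matrix.add_apply, Matrix.smul_apply, smul_eq_mul,
    edgeLap_apply_of_ne hij]
  rw [edgeLap_apply_eq_zero hij (by grind), edgeLap_apply_eq_zero hij (by grind)]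
  ring

/-- The numerator is the inner product of the sides at `i`, so the entry vanishes exactly when the
angle at `i` is right. -/
theorem angleCoeff_apply_adjacent {n : ℕ} {p : Config n} {k i j : Fin n} (hki : k ≠ i)
    (hkj : k ≠ j) (hij : i ≠ j) (h1 : relPos p k i ≠ 0) (h2 : relPos p k j ≠ 0) :
    angleCoeff p (k, i, j) k i = -(1 / (‖relPos p k i‖ * ‖relPos p k j‖)
      * (inner ℝ (relPos p k i) (relPos p j i) / ‖relPos p k i‖ ^ 2)) := by
  have hn1 := norm_ne_zero_iff.2 h1
  have hn2 := norm_ne_zero_iff.2 h2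
  simp only [angleCoeff, Matrix.sub_apply, Matrix.add_apply, Matrix.smul_apply, smul_eq_mul,
    edgeLap_apply_of_ne hki]
  rw [edgeLap_apply_eq_zero hki (by grind), edgeLap_apply_eq_zero hki (by grind),
    ← relPos_sub_relPos p k j i, inner_sub_right, real_inner_self_eq_norm_sq, cosAngle]
  field_simp
  ring

theorem relPos_neg {n : ℕ} (p : Config n) (i j : Fin n) : -relPos p i j = relPos p j i := by
  simp [relPos]

/-- The entries of the matrix of `cos θ^k_{ij}`, in terms of the two sides at `j`. -/
theorem angleCoeff_entries {p : Config 3} {k i j : Fin 3} (hki : k ≠ i) (hkj : k ≠ j)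
    (hij : i ≠ j) (h1 : relPos p k i ≠ 0) (h2 : relPos p k j ≠ 0) :
    angleCoeff p (k, i, j) i j = 1 / (‖relPos p k i‖ * ‖relPos p k j‖) ∧
      angleCoeff p (k, i, j) k j = -(1 / (‖relPos p k i‖ * ‖relPos p k j‖)
        * (inner ℝ (relPos p i j) (relPos p k j) / ‖relPos p k j‖ ^ 2)) ∧
      angleCoeff p (k, i, j) k i = -(1 / (‖relPos p k i‖ * ‖relPos p k j‖)
        * ((‖relPos p i j‖ ^ 2 - inner ℝ (relPos p i j) (relPos p k j)) / ‖relPos p k i‖ ^ 2)) := by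
  refine ⟨angleCoeff_apply_opposite p hki hkj hij, ?_, ?_⟩
  · rw [angleCoeff_swap, angleCoeff_apply_adjacent hkj hki hij.symm h2 h1,
      real_inner_comm (relPos p k j), mul_comm ‖relPos p k i‖]
  · rw [angleCoeff_apply_adjacent hki hkj hij h1 h2]
    congr 3
    rw [← relPos_sub_relPos p i k j, ← relPos_neg p i j,
      ← relPos_neg p i k, ← real_inner_self_eq_norm_sq]
    simp only [inner_sub_right, inner_neg_left, inner_neg_right]
    rw [real_inner_comm (relPos p i j) (relPos p i k)]
    ring

theorem relPos_ne_zero_of_not_collinear {p : Config 3}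
    (hp : ¬ Collinear ℝ (Set.range (agent p))) {i j : Fin 3} (hij : i ≠ j) :
    relPos p i j ≠ 0 := by
  intro h0
  have hthird : ∀ i j : Fin 3, ∃ k, k ≠ i ∧ k ≠ j := by decide
  obtain ⟨k, hki, hkj⟩ := hthird i j
  exact hp (collinear_range_agent_of_relPos_eq_smul hki.symm hij hkj (r := 0) (by simp [h0]))

/-- Strict Cauchy–Schwarz for the sides at `j`: it supplies the nonzero determinant for the
elimination with two angles. -/
theorem inner_sq_lt_of_not_collinear {p : Config 3}
    (hp : ¬ Collinear ℝ (Set.range (agent p))) {k i j : Fin 3} (hki : k ≠ i) (hkj : k ≠ j)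
    (hij : i ≠ j) : inner ℝ (relPos p i j) (relPos p k j) ^ 2
      < ‖relPos p i j‖ ^ 2 * ‖relPos p k j‖ ^ 2 := by
  have h := abs_cosAngle_lt_one hp (a := (j, i, k)) hij.symm hkj.symm hki.symm
  have h1 := norm_pos_iff.2 (relPos_ne_zero_of_not_collinear hp hij.symm)
  have h2 := norm_pos_iff.2 (relPos_ne_zero_of_not_collinear hp hkj.symm)
  simp only [cosAngle] at h
  rw [abs_div, abs_of_pos (mul_pos h1 h2), div_lt_one (mul_pos h1 h2)] at h
  rw [← relPos_neg p j i, ← relPos_neg p j k, inner_neg_neg, norm_neg, norm_neg, ← mul_pow,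
    ← sq_abs]
  exact pow_lt_pow_left₀ h (abs_nonneg _) two_ne_zero

theorem weightedMatrix_single_inr {n : ℕ} {G : SimpleGraph (Fin n)} [DecidableRel G.Adj]
    {A : Finset (Fin n × Fin n × Fin n)} (p : Config n) (a : A) (c : ℝ) :
    weightedMatrix G A p (Sum.elim 0 (Pi.single a c)) = c • angleCoeff p a.1 := by
  simp [weightedMatrix, Pi.single_apply, ite_smul]

theorem IsMinimallyGIWR.angleCoeff_ne_zero {n : ℕ} {G : SimpleGraph (Fin n)} [DecidableRel G.Adj]
    {A : Finset (Fin n × Fin n × Fin n)} {p : Config n} (h : IsMinimallyGIWR G A p)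
    {a : Fin n × Fin n × Fin n} (ha : a ∈ A) : angleCoeff p a ≠ 0 := by
  intro h0
  have h1 := h.weight_eq_zero (l := Sum.elim 0 (Pi.single ⟨a, ha⟩ 1))
    (by rw [weightedMatrix_single_inr, h0, smul_zero])
  simpa using congrFun h1 (Sum.inr ⟨a, ha⟩)

/-- Two triples with the same matrix would be dependent with weights `1` and `-1`. -/
theorem IsMinimallyGIWR.angleCoeff_injOn {n : ℕ} {G : SimpleGraph (Fin n)} [DecidableRel G.Adj]
    {A : Finset (Fin n × Fin n × Fin n)} {p : Config n} (h : IsMinimallyGIWR G A p) :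
    Set.InjOn (angleCoeff p) A := by
  intro a ha b hb hab
  by_contra hne
  have h1 := h.weight_eq_zero (l := Sum.elim 0 (Pi.single ⟨a, ha⟩ 1 - Pi.single ⟨b, hb⟩ 1)) (by
    simp [weightedMatrix, Pi.single_apply, ite_smul, sub_smul, hab])
  simpa [hne] using congrFun h1 (Sum.inr ⟨a, ha⟩)

/-- The angle constraints of a minimally rigid framework are attached to three distinct agents. -/
theorem IsMinimallyGIWR.ne_of_mem {n : ℕ} {G : SimpleGraph (Fin n)} [DecidableRel G.Adj]
    {A : Finset (Fin n × Fin n × Fin n)} {p : Config n} (h : IsMinimallyGIWR G A p)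
    {a : Fin n × Fin n × Fin n} (ha : a ∈ A) :
    a.1 ≠ a.2.1 ∧ a.1 ≠ a.2.2 ∧ a.2.1 ≠ a.2.2 := by
  obtain ⟨h1, h2⟩ := h.1.1 a ha
  refine ⟨fun he => h1 (by rw [← he]), fun he => h2 (by rw [← he]), fun he => ?_⟩
  have hr := relPos_ne_zero_of_mem_domainSet h.1.1 ha
  apply h.angleCoeff_ne_zero ha
  rw [angleCoeff, cosAngle_eq_one hr.1 he, ← he]
  simp [edgeLap, ← sq]

/-- Among three agents the vertex determines the two arms up to order, and the order does not affect
the matrix. -/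
theorem IsMinimallyGIWR.vertex_injOn {G : SimpleGraph (Fin 3)} [DecidableRel G.Adj]
    {A : Finset (Fin 3 × Fin 3 × Fin 3)} {p : Config 3} (h : IsMinimallyGIWR G A p)
    {a b : Fin 3 × Fin 3 × Fin 3} (ha : a ∈ A) (hb : b ∈ A) (hab : a.1 = b.1) : a = b := by
  refine h.angleCoeff_injOn ha hb ?_
  have h1 := h.ne_of_mem ha
  have h2 := h.ne_of_mem hb
  obtain ⟨k, i, j⟩ := a
  obtain ⟨k', i', j'⟩ := b
  simp only at hab h1 h2
  subst hab
  have hcase : (i' = i ∧ j' = j) ∨ (i' = j ∧ j' = i) := by lia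
  rcases hcase with ⟨rfl, rfl⟩ | ⟨rfl, rfl⟩
  · rfl
  · exact angleCoeff_swap _ _ _ _

/-- The matrix of the angle at `k` in a triangle `kij` does not depend on the order of `i, j`. -/
theorem angleCoeff_eq_of_vertex {p : Config 3} {a : Fin 3 × Fin 3 × Fin 3} {k i j : Fin 3}
    (ha : a.1 ≠ a.2.1 ∧ a.1 ≠ a.2.2 ∧ a.2.1 ≠ a.2.2) (hk : a.1 = k) (hki : k ≠ i) (hkj : k ≠ j)
    (hij : i ≠ j) : angleCoeff p a = angleCoeff p (k, i, j) := by
  obtain ⟨k', i', j'⟩ := a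
  simp only at hk ha
  subst hk
  have hcase : (i' = i ∧ j' = j) ∨ (i' = j ∧ j' = i) := by lia
  rcases hcase with ⟨rfl, rfl⟩ | ⟨rfl, rfl⟩
  · rfl
  · exact angleCoeff_swap _ _ _ _

theorem three_le_card_edgeFinset {n : ℕ} {G : SimpleGraph (Fin n)} [DecidableRel G.Adj]
    {k i j : Fin n} (h1 : G.Adj k i) (h2 : G.Adj k j) (h3 : G.Adj i j) :
    3 ≤ G.edgeFinset.card := by
  have hsub : ({s(k, i), s(k, j), s(i, j)} : Finset (Sym2 (Fin n))) ⊆ G.edgeFinset := by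
    intro s hs
    simp only [Finset.mem_insert, Finset.mem_singleton] at hs
    rw [SimpleGraph.mem_edgeFinset]
    rcases hs with rfl | rfl | rfl
    exacts [h1, h2, h3]
  have hcard : ({s(k, i), s(k, j), s(i, j)} : Finset (Sym2 (Fin n))).card = 3 := by
    have n1 := h1.ne
    have n2 := h2.ne
    have n3 := h3.ne
    rw [Finset.card_eq_three]
    exact ⟨_, _, _, by grind, by grind, by grind, rfl⟩
  exact hcard ▸ Finset.card_le_card hsub

theorem two_le_card_edgeFinset {n : ℕ} {G : SimpleGraph (Fin n)} [DecidableRel G.Adj]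
    {k i j : Fin n} (h1 : G.Adj k i) (h2 : G.Adj k j) (hij : i ≠ j) :
    2 ≤ G.edgeFinset.card := by
  have hsub : ({s(k, i), s(k, j)} : Finset (Sym2 (Fin n))) ⊆ G.edgeFinset := by
    intro s hs
    simp only [Finset.mem_insert, Finset.mem_singleton] at hs
    rw [SimpleGraph.mem_edgeFinset]
    rcases hs with rfl | rfl
    exacts [h1, h2]
  have hcard : ({s(k, i), s(k, j)} : Finset (Sym2 (Fin n))).card = 2 :=
    Finset.card_pair (by grind)
  exact hcard ▸ Finset.card_le_card hsub

theorem Matrix.eq_zero_of_isHermitian_of_offDiag {M : Matrix (Fin 3) (Fin 3) ℝ}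
    (hM : M.IsHermitian) (h1 : M.mulVec 1 = 0) {k i j : Fin 3} (hki : k ≠ i) (hkj : k ≠ j)
    (hij : i ≠ j) (h : M i j = 0) (h' : M k i = 0) (h'' : M k j = 0) : M = 0 := by
  have hs : ∀ i j, M i j = M j i := fun i j => by simpa using hM.apply j i
  have hoff : ∀ x y, x ≠ y → M x y = 0 := by
    intro x y hxy
    have hx : x = k ∨ x = i ∨ x = j := by lia
    have hy : y = k ∨ y = i ∨ y = j := by lia
    rcases hx with rfl | rfl | rfl <;> rcases hy with rfl | rfl | rfl <;>
      first | exact absurd rfl hxy | assumption | (rw [hs]; assumption)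
  exact Matrix.eq_zero_of_isHermitian_of_mulVec_one hM h1 (hoff 0 1 (by decide))
    (hoff 0 2 (by decide)) (hoff 1 2 (by decide))

/-- The infinitesimal form of `θ_k + θ_i + θ_j = π`. -/
theorem angleCoeff_sum_apply {p : Config 3} {k i j : Fin 3} (hki : k ≠ i) (hkj : k ≠ j)
    (hij : i ≠ j) (h1 : relPos p k i ≠ 0) (h2 : relPos p k j ≠ 0) (h3 : relPos p i j ≠ 0) :
    ‖relPos p k i‖ * ‖relPos p k j‖ * angleCoeff p (k, i, j) i j
      + ‖relPos p i k‖ * ‖relPos p i j‖ * angleCoeff p (i, k, j) i j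
      + ‖relPos p j k‖ * ‖relPos p j i‖ * angleCoeff p (j, k, i) i j = 0 := by
  have hs : angleCoeff p (j, k, i) i j = angleCoeff p (j, k, i) j i := by
    simpa using (isHermitian_angleCoeff p (j, k, i)).apply j i
  have hn1 := norm_ne_zero_iff.2 h1
  have hn2 := norm_ne_zero_iff.2 h2
  have hn3 := norm_ne_zero_iff.2 h3
  have hneg : ∀ x y, relPos p x y ≠ 0 → relPos p y x ≠ 0 := fun x y h => by
    rwa [← relPos_neg, neg_ne_zero]
  rw [hs, angleCoeff_apply_opposite p hki hkj hij, angleCoeff_swap p i k j,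
    angleCoeff_apply_adjacent hij hki.symm hkj.symm h3 (hneg _ _ h1), angleCoeff_swap p j k i,
    angleCoeff_apply_adjacent hij.symm hkj.symm hki.symm (hneg _ _ h3) (hneg _ _ h2),
    relPos_norm_comm p i k, relPos_norm_comm p j k, relPos_norm_comm p j i]
  have hsum : inner ℝ (relPos p i j) (relPos p k j) + inner ℝ (relPos p j i) (relPos p k i)
      = ‖relPos p i j‖ ^ 2 := by
    rw [← relPos_neg p i j, inner_neg_left, ← sub_eq_add_neg, ← inner_sub_right,
      relPos_sub_relPos, real_inner_self_eq_norm_sq]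
  field_simp
  linear_combination -hsum

/-- The three angles of a triangle are dependent, so they cannot all be prescribed in a minimally
rigid framework. -/
theorem IsMinimallyGIWR.not_three_angles {G : SimpleGraph (Fin 3)} [DecidableRel G.Adj]
    {A : Finset (Fin 3 × Fin 3 × Fin 3)} {p : Config 3} (h : IsMinimallyGIWR G A p)
    {k i j : Fin 3} (hki : k ≠ i) (hkj : k ≠ j) (hij : i ≠ j) {a b c : Fin 3 × Fin 3 × Fin 3}
    (ha : a ∈ A) (hb : b ∈ A) (hc : c ∈ A) (hak : a.1 = k) (hbi : b.1 = i) (hcj : c.1 = j) :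
    False := by
  have hcol := h.1.not_collinear
  have hn : ∀ x y : Fin 3, x ≠ y → relPos p x y ≠ 0 := fun x y hxy =>
    relPos_ne_zero_of_not_collinear hcol hxy
  have hab : a ≠ b := fun he => hki (by rw [← hak, ← hbi, he])
  have hac : a ≠ c := fun he => hkj (by rw [← hak, ← hcj, he])
  have hbc : b ≠ c := fun he => hij (by rw [← hbi, ← hcj, he])
  -- The product of the sides at a vertex times the sine of its angle is twice the area, the same at
  -- each vertex; with these weights the differentials of the cosines become a common multiple of
  -- those of the angles, which sum to zero.
  set wa := ‖relPos p k i‖ * ‖relPos p k j‖ with hwa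
  set wb := ‖relPos p i k‖ * ‖relPos p i j‖ with hwb
  set wc := ‖relPos p j k‖ * ‖relPos p j i‖ with hwc
  have hwa0 : wa ≠ 0 :=
    mul_ne_zero (norm_ne_zero_iff.2 (hn _ _ hki)) (norm_ne_zero_iff.2 (hn _ _ hkj))
  have hwb0 : wb ≠ 0 :=
    mul_ne_zero (norm_ne_zero_iff.2 (hn _ _ hki.symm)) (norm_ne_zero_iff.2 (hn _ _ hij))
  have hwc0 : wc ≠ 0 :=
    mul_ne_zero (norm_ne_zero_iff.2 (hn _ _ hkj.symm)) (norm_ne_zero_iff.2 (hn _ _ hij.symm))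
  let l : Constraint G A → ℝ := Sum.elim 0
    (Pi.single ⟨a, ha⟩ wa + Pi.single ⟨b, hb⟩ wb + Pi.single ⟨c, hc⟩ wc)
  have hW : weightedMatrix G A p l
      = wa • angleCoeff p a + wb • angleCoeff p b + wc • angleCoeff p c := by
    simp [l, weightedMatrix, Pi.single_apply, ite_smul, add_smul, Finset.sum_add_distrib]
  have hzero : weightedMatrix G A p l = 0 := by
    have da := h.ne_of_mem ha
    have db := h.ne_of_mem hb
    have dc := h.ne_of_mem hc
    refine Matrix.eq_zero_of_isHermitian_of_offDiag (isHermitian_weightedMatrix G A p l)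
      (weightedMatrix_mulVec_one G A p l) hki hkj hij ?_ ?_ ?_ <;>
    simp only [hW, Matrix.add_apply, Matrix.smul_apply, smul_eq_mul, hwa, hwb, hwc]
    · rw [angleCoeff_eq_of_vertex da hak hki hkj hij,
        angleCoeff_eq_of_vertex db hbi hki.symm hij hkj,
        angleCoeff_eq_of_vertex dc hcj hkj.symm hij.symm hki]
      exact angleCoeff_sum_apply hki hkj hij (hn _ _ hki) (hn _ _ hkj) (hn _ _ hij)
    · rw [angleCoeff_eq_of_vertex da hak hkj hki hij.symm,
        angleCoeff_eq_of_vertex db hbi hij hki.symm hkj.symm,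
        angleCoeff_eq_of_vertex dc hcj hkj.symm hij.symm hki]
      linear_combination angleCoeff_sum_apply hkj.symm hij.symm hki (hn _ _ hkj.symm)
        (hn _ _ hij.symm) (hn _ _ hki)
    · rw [angleCoeff_eq_of_vertex da hak hki hkj hij,
        angleCoeff_eq_of_vertex db hbi hki.symm hij hkj,
        angleCoeff_eq_of_vertex dc hcj hij.symm hkj.symm hki.symm]
      linear_combination angleCoeff_sum_apply hki.symm hij hkj (hn _ _ hki.symm)
        (hn _ _ hij) (hn _ _ hkj)
  have h0 := congrFun (h.weight_eq_zero hzero) (Sum.inr ⟨a, ha⟩)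
  simp [l, hab, hac] at h0
  exact hwa0 h0

/-! ### Dependencies at noncollinear configurations -/

theorem edgeWeight_eq_zero_of_distinct {G : SimpleGraph (Fin 3)} [DecidableRel G.Adj]
    {A : Finset (Fin 3 × Fin 3 × Fin 3)} {l : Constraint G A → ℝ} {k i j : Fin 3} (hki : k ≠ i)
    (hkj : k ≠ j) (hij : i ≠ j) (h : edgeWeight l i j = 0) (h' : edgeWeight l k i = 0)
    (h'' : edgeWeight l k j = 0) (x y : Fin 3) (hxy : x ≠ y) : edgeWeight l x y = 0 := by
  have hx : x = k ∨ x = i ∨ x = j := by lia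
  have hy : y = k ∨ y = i ∨ y = j := by lia
  rcases hx with rfl | rfl | rfl <;> rcases hy with rfl | rfl | rfl <;>
    first | exact absurd rfl hxy | assumption | (rw [edgeWeight_comm]; assumption)

/-- The equations satisfied by a dependency between a single angle at `k` and the distances. -/
theorem single_angle_equations {G : SimpleGraph (Fin 3)} [DecidableRel G.Adj]
    {A : Finset (Fin 3 × Fin 3 × Fin 3)} {p : Config 3} (hp : ¬ Collinear ℝ (Set.range (agent p)))
    {l : Constraint G A → ℝ} (hl : weightedMatrix G A p l = 0) {k i j : Fin 3} (hki : k ≠ i)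
    (hkj : k ≠ j) (hij : i ≠ j) {a : A} (ha : a.1.1 ≠ a.1.2.1 ∧ a.1.1 ≠ a.1.2.2 ∧
      a.1.2.1 ≠ a.1.2.2) (hak : a.1.1 = k) (hA : ∀ b : A, b = a) :
    2 * edgeWeight l i j = l (Sum.inr a) / (‖relPos p k i‖ * ‖relPos p k j‖) ∧
    2 * edgeWeight l k j = -(l (Sum.inr a) / (‖relPos p k i‖ * ‖relPos p k j‖)
      * (inner ℝ (relPos p i j) (relPos p k j) / ‖relPos p k j‖ ^ 2)) ∧
    2 * edgeWeight l k i = -(l (Sum.inr a) / (‖relPos p k i‖ * ‖relPos p k j‖)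
      * ((‖relPos p i j‖ ^ 2 - inner ℝ (relPos p i j) (relPos p k j)) / ‖relPos p k i‖ ^ 2)) := by
  have hsum : ∀ x y, x ≠ y →
      -2 * edgeWeight l x y + l (Sum.inr a) * angleCoeff p (k, i, j) x y = 0 := by
    intro x y hxy
    have h1 := weightedMatrix_apply G A p l hxy
    rw [hl, Fintype.sum_eq_single a (fun b hb => absurd (hA b) hb),
      angleCoeff_eq_of_vertex ha hak hki hkj hij] at h1
    exact h1.symm
  obtain ⟨e1, e2, e3⟩ := angleCoeff_entries hki hkj hij
    (relPos_ne_zero_of_not_collinear hp hki) (relPos_ne_zero_of_not_collinear hp hkj)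
  have s1 := hsum i j hij
  have s2 := hsum k j hkj
  have s3 := hsum k i hki
  rw [e1] at s1
  rw [e2] at s2
  rw [e3] at s3
  refine ⟨?_, ?_, ?_⟩
  · linear_combination -s1
  · linear_combination -s2
  · linear_combination -s3

/-- Clearing denominators, any two of the three equations with vanishing left side form a linear
system in `α, β` of determinant `±(X * Y - c ^ 2)`, which is nonzero. -/
theorem two_angle_elimination {X Y Z c α β e₁ e₂ e₃ : ℝ} (hX : 0 < X) (hY : 0 < Y) (hZ : 0 < Z)
    (hc : c ^ 2 < X * Y) (h1 : 2 * e₁ = α - β * (c / X)) (h2 : 2 * e₂ = -(α * (c / Y)) + β)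
    (h3 : 2 * e₃ = -(α * ((X - c) / Z)) - β * ((Y - c) / Z))
    (hz : (e₁ = 0 ∧ e₂ = 0) ∨ (e₁ = 0 ∧ e₃ = 0) ∨ (e₂ = 0 ∧ e₃ = 0)) : α = 0 ∧ β = 0 := by
  have h1' : 2 * e₁ * X = α * X - β * c := by rw [h1]; field_simp
  have h2' : 2 * e₂ * Y = β * Y - α * c := by rw [h2]; field_simp; ring
  have h3' : 2 * e₃ * Z = -(α * (X - c)) - β * (Y - c) := by rw [h3]; field_simp
  have hd : X * Y - c ^ 2 ≠ 0 := by linarith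
  rcases hz with ⟨rfl, rfl⟩ | ⟨rfl, rfl⟩ | ⟨rfl, rfl⟩
  · constructor
    · refine (mul_eq_zero.1 (?_ : (X * Y - c ^ 2) * α = 0)).resolve_left hd
      linear_combination -Y * h1' - c * h2'
    · refine (mul_eq_zero.1 (?_ : (X * Y - c ^ 2) * β = 0)).resolve_left hd
      linear_combination -c * h1' - X * h2'
  · have hβ : β = 0 := by
      refine (mul_eq_zero.1 (?_ : (X * Y - c ^ 2) * β = 0)).resolve_left hd
      linear_combination (X - c) * h1' + X * h3'
    refine ⟨(mul_eq_zero.1 (?_ : X * α = 0)).resolve_left hX.ne', hβ⟩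
    rw [hβ] at h1'
    linear_combination -h1'
  · have hα : α = 0 := by
      refine (mul_eq_zero.1 (?_ : (X * Y - c ^ 2) * α = 0)).resolve_left hd
      linear_combination (Y - c) * h2' + Y * h3'
    refine ⟨hα, (mul_eq_zero.1 (?_ : Y * β = 0)).resolve_left hY.ne'⟩
    rw [hα] at h2'
    linear_combination -h2'

/-- Two angles and at most one distance are independent at a noncollinear configuration. -/
theorem two_angles_independent {G : SimpleGraph (Fin 3)} [DecidableRel G.Adj]
    {A : Finset (Fin 3 × Fin 3 × Fin 3)} {p : Config 3} (hp : ¬ Collinear ℝ (Set.range (agent p)))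
    {l : Constraint G A → ℝ} (hl : weightedMatrix G A p l = 0) (hG : G.edgeFinset.card ≤ 1)
    {a b : A} (ha : a.1.1 ≠ a.1.2.1 ∧ a.1.1 ≠ a.1.2.2 ∧ a.1.2.1 ≠ a.1.2.2)
    (hb : b.1.1 ≠ b.1.2.1 ∧ b.1.1 ≠ b.1.2.2 ∧ b.1.2.1 ≠ b.1.2.2) (hab : a.1.1 ≠ b.1.1)
    (hA : ∀ c : A, c = a ∨ c = b) : l = 0 := by
  obtain ⟨j, hkj, hij⟩ : ∃ j, a.1.1 ≠ j ∧ b.1.1 ≠ j := by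
    have hthird : ∀ k i : Fin 3, ∃ j, k ≠ j ∧ i ≠ j := by decide
    exact hthird _ _
  set k := a.1.1 with hk
  set i := b.1.1 with hi
  have hki := hab
  have hne : a ≠ b := fun h => hab (by rw [hk, hi, h])
  have hn : ∀ x y : Fin 3, x ≠ y → relPos p x y ≠ 0 := fun x y hxy =>
    relPos_ne_zero_of_not_collinear hp hxy
  have hsum : ∀ x y, x ≠ y → -2 * edgeWeight l x y + (l (Sum.inr a) * angleCoeff p (k, i, j) x y
      + l (Sum.inr b) * angleCoeff p (i, k, j) x y) = 0 := by
    intro x y hxy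
    have h1 := weightedMatrix_apply G A p l hxy
    rw [hl, Fintype.sum_eq_add a b hne (fun c hc => by
        rcases hA c with h | h
        · exact absurd h hc.1
        · exact absurd h hc.2),
      angleCoeff_eq_of_vertex ha rfl hki hkj hij,
      angleCoeff_eq_of_vertex hb rfl hki.symm hij hkj] at h1
    exact h1.symm
  obtain ⟨e1, e2, e3⟩ := angleCoeff_entries hki hkj hij (hn _ _ hki) (hn _ _ hkj)
  obtain ⟨f1, f2, f3⟩ := angleCoeff_entries hki.symm hij hkj (hn _ _ hki.symm) (hn _ _ hij)
  have f3' : angleCoeff p (i, k, j) k i = angleCoeff p (i, k, j) i k := by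
    simpa using (isHermitian_angleCoeff p (i, k, j)).apply i k
  have s1 := hsum i j hij
  have s2 := hsum k j hkj
  have s3 := hsum k i hki
  rw [e1, f2] at s1
  rw [e2, f1] at s2
  rw [e3, f3', f3] at s3
  rw [real_inner_comm (relPos p i j) (relPos p k j)] at s1 s3
  rw [relPos_norm_comm p i k] at s1 s2 s3
  have hX := norm_pos_iff.2 (hn _ _ hij)
  have hY := norm_pos_iff.2 (hn _ _ hkj)
  have hZ := norm_pos_iff.2 (hn _ _ hki)
  have hc := inner_sq_lt_of_not_collinear hp hki hkj hij
  -- At most one side carries an edge, so at least two of the three edge weights vanish.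
  have hz : (edgeWeight l i j = 0 ∧ edgeWeight l k j = 0) ∨
      (edgeWeight l i j = 0 ∧ edgeWeight l k i = 0) ∨
      (edgeWeight l k j = 0 ∧ edgeWeight l k i = 0) := by
    by_cases g1 : G.Adj i j
    · have g2 : ¬ G.Adj k j := fun g => by
        have := two_le_card_edgeFinset g.symm g1.symm hki
        omega
      have g3 : ¬ G.Adj k i := fun g => by
        have := two_le_card_edgeFinset g.symm g1 hkj
        omega
      exact Or.inr (Or.inr ⟨edgeWeight_of_not_adj l g2, edgeWeight_of_not_adj l g3⟩)
    · by_cases g2 : G.Adj k j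
      · have g3 : ¬ G.Adj k i := fun g => by
          have := two_le_card_edgeFinset g g2 hij
          omega
        exact Or.inr (Or.inl ⟨edgeWeight_of_not_adj l g1, edgeWeight_of_not_adj l g3⟩)
      · exact Or.inl ⟨edgeWeight_of_not_adj l g1, edgeWeight_of_not_adj l g2⟩
  obtain ⟨hα, hβ⟩ := two_angle_elimination
    (α := l (Sum.inr a) * (1 / (‖relPos p k i‖ * ‖relPos p k j‖)))
    (β := l (Sum.inr b) * (1 / (‖relPos p k i‖ * ‖relPos p i j‖)))
    (pow_pos hX 2) (pow_pos hY 2) (pow_pos hZ 2) hc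
    (e₁ := edgeWeight l i j) (e₂ := edgeWeight l k j) (e₃ := edgeWeight l k i)
    (by linear_combination -s1) (by linear_combination -s2) (by linear_combination -s3) hz
  have hla : l (Sum.inr a) = 0 := (mul_eq_zero.1 hα).resolve_right (by positivity)
  have hlb : l (Sum.inr b) = 0 := (mul_eq_zero.1 hβ).resolve_right (by positivity)
  rw [hla, hlb] at s1 s2 s3
  have hw := edgeWeight_eq_zero_of_distinct hki hkj hij (l := l) (by linarith) (by linarith)
    (by linarith)
  ext c
  rcases c with s | c
  · exact weight_inl_eq_zero hw s
  · rcases hA c with rfl | rfl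
    exacts [hla, hlb]

/-- At a noncollinear configuration, the constraints of a minimally rigid framework are independent,
except where two distances and an angle not between them meet in a right angle. -/
theorem exists_right_angle_of_dependent {G : SimpleGraph (Fin 3)} [DecidableRel G.Adj]
    {A : Finset (Fin 3 × Fin 3 × Fin 3)} {pd p : Config 3} (h : IsMinimallyGIWR G A pd)
    (hp : ¬ Collinear ℝ (Set.range (agent p))) {l : Constraint G A → ℝ}
    (hl : weightedMatrix G A p l = 0) (hne : l ≠ 0) :
    ∃ (k i j : Fin 3) (a : A), k ≠ i ∧ k ≠ j ∧ i ≠ j ∧ a.1.1 = k ∧ (∀ b : A, b = a) ∧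
      G.Adj i j ∧ G.Adj k i ∧ ¬ G.Adj k j ∧ G.edgeFinset.card = 2 ∧
      l (Sum.inr a) ≠ 0 ∧ inner ℝ (relPos p i j) (relPos p k j) = 0 ∧
      2 * edgeWeight l i j = l (Sum.inr a) / (‖relPos p k i‖ * ‖relPos p k j‖) ∧
      2 * edgeWeight l k i = -(l (Sum.inr a) / (‖relPos p k i‖ * ‖relPos p k j‖)
        * (‖relPos p i j‖ ^ 2 / ‖relPos p k i‖ ^ 2)) := by
  have hcard := h.card_le
  have hA3 : A.card ≤ 3 := by omega
  have hn : ∀ x y : Fin 3, x ≠ y → 0 < ‖relPos p x y‖ := fun x y hxy =>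
    norm_pos_iff.2 (relPos_ne_zero_of_not_collinear hp hxy)
  -- The cases are the numbers of angles. Without angles, off-diagonal entries separate the edges;
  -- two angles leave room for one edge only; three are excluded by the angle sum. The exception
  -- arises from a single angle.
  interval_cases hA : A.card
  · have hemp : IsEmpty A := by
      rw [Finset.card_eq_zero.1 hA]
      infer_instance
    refine absurd ?_ hne
    ext c
    rcases c with s | c
    · refine weight_inl_eq_zero (fun i j hij => ?_) s
      have h1 := weightedMatrix_apply G A p l hij
      rw [hl] at h1
      simpa using h1
    · exact hemp.elim c
  · obtain ⟨a, rfl⟩ := Finset.card_eq_one.1 hA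
    set a' : ({a} : Finset (Fin 3 × Fin 3 × Fin 3)) := ⟨a, Finset.mem_singleton_self a⟩ with ha'
    have hall : ∀ b : ({a} : Finset (Fin 3 × Fin 3 × Fin 3)), b = a' := fun b =>
      Subtype.ext (Finset.mem_singleton.1 b.2)
    have had := h.ne_of_mem a'.2
    have hla : l (Sum.inr a') ≠ 0 := by
      intro h0
      apply hne
      obtain ⟨s1, s2, s3⟩ := single_angle_equations hp hl had.1 had.2.1 had.2.2 had rfl hall
      simp only [h0, zero_div, zero_mul, neg_zero, mul_eq_zero, OfNat.ofNat_ne_zero,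
        false_or] at s1 s2 s3
      have hw := edgeWeight_eq_zero_of_distinct had.1 had.2.1 had.2.2 s1 s3 s2
      ext c
      rcases c with s | c
      · exact weight_inl_eq_zero hw s
      · rw [hall c]
        exact h0
    have hadj : ∀ x y, edgeWeight l x y ≠ 0 → G.Adj x y := fun x y hxy => by
      by_contra hn
      exact hxy (edgeWeight_of_not_adj l hn)
    have key : ∀ k i j : Fin 3, k ≠ i → k ≠ j → i ≠ j → a.1 = k → G.Adj k i →
        G.Adj i j ∧ G.Adj k i ∧ ¬ G.Adj k j ∧ G.edgeFinset.card = 2 ∧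
        l (Sum.inr a') ≠ 0 ∧ inner ℝ (relPos p i j) (relPos p k j) = 0 ∧
        2 * edgeWeight l i j = l (Sum.inr a') / (‖relPos p k i‖ * ‖relPos p k j‖) ∧
        2 * edgeWeight l k i = -(l (Sum.inr a') / (‖relPos p k i‖ * ‖relPos p k j‖)
          * (‖relPos p i j‖ ^ 2 / ‖relPos p k i‖ ^ 2)) := by
      intro k i j hki hkj hij hak g
      obtain ⟨s1, s2, s3⟩ := single_angle_equations hp hl hki hkj hij had hak hall
      have hX := hn k i hki
      have hY := hn k j hkj
      have hq : l (Sum.inr a') / (‖relPos p k i‖ * ‖relPos p k j‖) ≠ 0 :=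
        div_ne_zero hla (by positivity)
      have gij : G.Adj i j := hadj i j fun h0 => hq (by rw [← s1, h0, mul_zero])
      -- Three edges and the angle would be four constraints. With `kj` absent, the `kj` entry
      -- forces the right angle at `j`.
      have gkj : ¬ G.Adj k j := fun gkj => by
        have := three_le_card_edgeFinset g gkj gij
        omega
      have h2 := two_le_card_edgeFinset g.symm gij hkj
      have hin : inner ℝ (relPos p i j) (relPos p k j) = 0 := by
        rw [edgeWeight_of_not_adj l gkj, mul_zero, eq_comm, neg_eq_zero, mul_eq_zero] at s2
        exact (div_eq_zero_iff.1 (s2.resolve_left hq)).resolve_right (by positivity)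
      rw [hin, sub_zero] at s3
      exact ⟨gij, g, gkj, by omega, hla, hin, s1, s3⟩
    obtain ⟨hki, hkj, hij⟩ := had
    by_cases g : G.Adj a.1 a.2.1
    · exact ⟨a.1, a.2.1, a.2.2, a', hki, hkj, hij, rfl, hall, key _ _ _ hki hkj hij rfl g⟩
    · by_cases g' : G.Adj a.1 a.2.2
      · exact ⟨a.1, a.2.2, a.2.1, a', hkj, hki, hij.symm, rfl, hall,
          key _ _ _ hkj hki hij.symm rfl g'⟩
      -- With no edge at the vertex, both adjacent entries vanish, so the angles at both other
      -- agents would be right; the two conditions add up to `‖z_ij‖² = 0`.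
      · exfalso
        obtain ⟨s1, s2, s3⟩ := single_angle_equations hp hl hki hkj hij ⟨hki, hkj, hij⟩ rfl hall
        have hX := hn _ _ hki
        have hY := hn _ _ hkj
        have hq : l (Sum.inr a') / (‖relPos p a.1 a.2.1‖ * ‖relPos p a.1 a.2.2‖) ≠ 0 :=
          div_ne_zero hla (by positivity)
        rw [edgeWeight_of_not_adj l g', mul_zero, eq_comm, neg_eq_zero, mul_eq_zero] at s2
        rw [edgeWeight_of_not_adj l g, mul_zero, eq_comm, neg_eq_zero, mul_eq_zero] at s3
        have t2 := (div_eq_zero_iff.1 (s2.resolve_left hq)).resolve_right (by positivity)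
        have t3 := (div_eq_zero_iff.1 (s3.resolve_left hq)).resolve_right (by positivity)
        have := pow_pos (hn _ _ hij) 2
        linarith
  · obtain ⟨a, b, hab, rfl⟩ := Finset.card_eq_two.1 hA
    have ha : a ∈ ({a, b} : Finset (Fin 3 × Fin 3 × Fin 3)) := by simp
    have hb : b ∈ ({a, b} : Finset (Fin 3 × Fin 3 × Fin 3)) := by simp
    refine absurd (two_angles_independent hp hl (by omega) (a := ⟨a, ha⟩) (b := ⟨b, hb⟩)
      (h.ne_of_mem ha) (h.ne_of_mem hb) (fun he => hab (h.vertex_injOn ha hb he)) ?_) hne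
    rintro ⟨c, hc⟩
    simpa using hc
  · obtain ⟨a, b, c, hab, hac, hbc, rfl⟩ := Finset.card_eq_three.1 hA
    have ha : a ∈ ({a, b, c} : Finset (Fin 3 × Fin 3 × Fin 3)) := by simp
    have hb : b ∈ ({a, b, c} : Finset (Fin 3 × Fin 3 × Fin 3)) := by simp
    have hc : c ∈ ({a, b, c} : Finset (Fin 3 × Fin 3 × Fin 3)) := by simp
    exact (h.not_three_angles (fun he => hab (h.vertex_injOn ha hb he))
      (fun he => hac (h.vertex_injOn ha hc he)) (fun he => hbc (h.vertex_injOn hb hc he))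
      ha hb hc rfl rfl rfl).elim

/-! ### The right-angled exception -/

theorem cosAngle_eq_of_vertex {p : Config 3} {a : Fin 3 × Fin 3 × Fin 3} {k i j : Fin 3}
    (ha : a.1 ≠ a.2.1 ∧ a.1 ≠ a.2.2 ∧ a.2.1 ≠ a.2.2) (hk : a.1 = k) (hki : k ≠ i) (hkj : k ≠ j)
    (hij : i ≠ j) : cosAngle p a = cosAngle p (k, i, j) := by
  obtain ⟨k', i', j'⟩ := a
  simp only at hk ha
  subst hk
  have hcase : (i' = i ∧ j' = j) ∨ (i' = j ∧ j' = i) := by lia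
  rcases hcase with ⟨rfl, rfl⟩ | ⟨rfl, rfl⟩
  · rfl
  · simp only [cosAngle]
    rw [real_inner_comm, mul_comm]

/-- A triangle with a longer side `ki` and a shorter side `ij` than a triangle with a right angle at
`j` has the smaller angle at `k`. -/
theorem cosAngle_le_of_right_angle {n : ℕ} {p q : Config n} {k i j : Fin n}
    (hki : relPos p k i ≠ 0) (hkj : relPos p k j ≠ 0) (hkj' : relPos q k j ≠ 0)
    (hin : inner ℝ (relPos p i j) (relPos p k j) = 0)
    (h1 : ‖relPos q i j‖ ^ 2 ≤ ‖relPos p i j‖ ^ 2) (h2 : ‖relPos p k i‖ ^ 2 ≤ ‖relPos q k i‖ ^ 2) :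
    cosAngle p (k, i, j) ≤ cosAngle q (k, i, j) := by
  have hx := norm_pos_iff.2 hki
  have hz := norm_pos_iff.2 hkj
  have hz' := norm_pos_iff.2 hkj'
  have hx' : 0 < ‖relPos q k i‖ := by
    by_contra h
    have h0 : ‖relPos q k i‖ = 0 := le_antisymm (not_lt.1 h) (norm_nonneg _)
    rw [h0] at h2
    nlinarith
  have hsub : relPos p k i = relPos p k j - relPos p i j := by
    rw [← relPos_sub_relPos p k i j]
    abel
  have hpyth : ‖relPos p k i‖ ^ 2 = ‖relPos p k j‖ ^ 2 + ‖relPos p i j‖ ^ 2 := by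
    rw [hsub, norm_sub_sq_real, real_inner_comm, hin]
    ring
  have hcp : inner ℝ (relPos p k i) (relPos p k j) = ‖relPos p k j‖ ^ 2 := by
    rw [hsub, inner_sub_left, hin, real_inner_self_eq_norm_sq, sub_zero]
  have hcq : 2 * inner ℝ (relPos q k i) (relPos q k j)
      = ‖relPos q k i‖ ^ 2 + ‖relPos q k j‖ ^ 2 - ‖relPos q i j‖ ^ 2 := by
    rw [← relPos_sub_relPos q k i j, norm_sub_sq_real, real_inner_comm (relPos q k i)]
    ring
  change inner ℝ (relPos p k i) (relPos p k j) / (‖relPos p k i‖ * ‖relPos p k j‖)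
    ≤ inner ℝ (relPos q k i) (relPos q k j) / (‖relPos q k i‖ * ‖relPos q k j‖)
  rw [hcp, div_le_div_iff₀ (by positivity) (by positivity)]
  generalize ‖relPos p k i‖ = x at *
  generalize ‖relPos p k j‖ = z at *
  generalize ‖relPos p i j‖ = y at *
  generalize ‖relPos q k i‖ = x' at *
  generalize ‖relPos q k j‖ = z' at *
  generalize ‖relPos q i j‖ = y' at *
  generalize inner ℝ (relPos q k i) (relPos q k j) = c at *
  have h3 : y' ^ 2 * x ^ 2 ≤ y ^ 2 * x' ^ 2 :=
    mul_le_mul h1 h2 (sq_nonneg _) (sq_nonneg _)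
  have h4 : z ^ 2 * x' ^ 2 ≤ x ^ 2 * (x' ^ 2 - y' ^ 2) := by
    have : z ^ 2 * x' ^ 2 = x ^ 2 * x' ^ 2 - y ^ 2 * x' ^ 2 := by rw [hpyth]; ring
    linarith
  -- Law of cosines with `h4`, followed by the arithmetic–geometric mean inequality for `z * x'` and
  -- `x * z'`.
  have h5 : 2 * (z * x') * (x * z') ≤ x ^ 2 * (2 * c) := by
    rw [hcq]
    nlinarith [sq_nonneg (z * x' - x * z')]
  have h6 : z * x' * z' ≤ c * x := by
    refine le_of_mul_le_mul_left ?_ hx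
    linarith
  calc z ^ 2 * (x' * z') = z * (z * x' * z') := by ring
    _ ≤ z * (c * x) := by gcongr
    _ = c * (x * z) := by ring

theorem edgeWeight_errorVec {n : ℕ} {G : SimpleGraph (Fin n)} [DecidableRel G.Adj]
    {A : Finset (Fin n × Fin n × Fin n)} (pd p : Config n) {i j : Fin n} (h : G.Adj i j) :
    edgeWeight (errorVec G A pd p) i j = ‖relPos p i j‖ ^ 2 - ‖relPos pd i j‖ ^ 2 := by
  rw [edgeWeight, dif_pos h]
  rfl

/-- Moving `j` along the side `kj` of a triangle with a right angle at `j` changes, to first order in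
the square of the displacement, only the length of `ij`. -/
theorem fderiv_fderiv_errorPotential_of_right_angle {G : SimpleGraph (Fin 3)} [DecidableRel G.Adj]
    {A : Finset (Fin 3 × Fin 3 × Fin 3)} (pd : Config 3) {p : Config 3} (hp : p ∈ domainSet A)
    {k i j : Fin 3} (hki : k ≠ i) (hkj : k ≠ j) (hij : i ≠ j) (gij : G.Adj i j)
    (gkj : ¬ G.Adj k j) (hin : inner ℝ (relPos p i j) (relPos p k j) = 0)
    (hA : ∀ a ∈ A, a.1 = k ∧ a.1 ≠ a.2.1 ∧ a.1 ≠ a.2.2 ∧ a.2.1 ≠ a.2.2) :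
    fderiv ℝ (fderiv ℝ (errorPotential G A pd)) p (tensorMotion (Pi.single j 1) (relPos p k j))
        (tensorMotion (Pi.single j 1) (relPos p k j))
      = 2 * (edgeWeight (errorVec G A pd p) i j * ‖relPos p k j‖ ^ 2) := by
  set v := tensorMotion (Pi.single j 1) (relPos p k j) with hv
  have hvij : relPos v i j = -relPos p k j := by
    rw [hv, relPos_tensorMotion]
    simp [hij]
  have hvkj : relPos v k j = -relPos p k j := by
    rw [hv, relPos_tensorMotion]
    simp [hkj]
  have hvki : relPos v k i = 0 := by
    rw [hv, relPos_tensorMotion]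
    simp [hkj, hij]
  let d : Constraint G A → ℝ := Pi.single (Sum.inl ⟨s(i, j), gij⟩) (‖relPos p k j‖ ^ 2)
  have hedge : ∀ (s : G.edgeSet) (t : ℝ),
      sqLength (p + t • v) s.1 = sqLength p s.1 + t ^ 2 * d (Sum.inl s) := by
    rintro ⟨s, hs⟩ t
    have hijn : ‖relPos (p + t • v) i j‖ ^ 2
        = ‖relPos p i j‖ ^ 2 + t ^ 2 * ‖relPos p k j‖ ^ 2 := by
      rw [relPos_add_smul, hvij, norm_add_sq_real, inner_smul_right, inner_neg_right, hin,
        norm_smul, norm_neg, mul_pow, Real.norm_eq_abs, sq_abs]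
      ring
    have hcase : s = s(i, j) ∨ s = s(k, i) := by
      induction s with
      | _ x y =>
        have g : G.Adj x y := hs
        have hxy := g.ne
        have hx : x = k ∨ x = i ∨ x = j := by lia
        have hy : y = k ∨ y = i ∨ y = j := by lia
        rcases hx with rfl | rfl | rfl <;> rcases hy with rfl | rfl | rfl <;>
          first | exact absurd rfl hxy | exact absurd g gkj | exact absurd g.symm gkj | simp
    rcases hcase with rfl | rfl
    · simp only [d, Pi.single_eq_same]
      exact hijn
    · have hne : s(k, i) ≠ s(i, j) := by grind
      have hd : d (Sum.inl ⟨s(k, i), hs⟩) = 0 :=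
        Pi.single_eq_of_ne (fun he => hne (Subtype.ext_iff.1 (Sum.inl.inj he))) _
      rw [hd, mul_zero, add_zero]
      change ‖relPos (p + t • v) k i‖ ^ 2 = ‖relPos p k i‖ ^ 2
      rw [relPos_add_smul, hvki, smul_zero, add_zero]
  -- For `t < 1` the agent `j` stays on the same ray from `k`, so the direction of `kj` and hence
  -- the angle at `k` do not change.
  have hangle : ∀ (a : A) (t : ℝ), t < 1 → cosAngle (p + t • v) a.1 = cosAngle p a.1 := by
    intro a t ht
    obtain ⟨hk, ha⟩ := hA a.1 a.2
    rw [cosAngle_eq_of_vertex ha hk hki hkj hij, cosAngle_eq_of_vertex ha hk hki hkj hij]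
    have h1 : relPos (p + t • v) k j = (1 - t) • relPos p k j := by
      rw [relPos_add_smul, hvkj, sub_smul, one_smul, smul_neg, sub_eq_add_neg]
    have h2 : relPos (p + t • v) k i = relPos p k i := by
      rw [relPos_add_smul, hvki, smul_zero, add_zero]
    have ht' : 0 < 1 - t := by linarith
    simp only [cosAngle]
    rw [h1, h2, inner_smul_right, norm_smul, Real.norm_of_nonneg ht'.le, mul_left_comm,
      mul_div_mul_left _ _ ht'.ne']
  have hh : ContDiffAt ℝ 1 (fun τ : ℝ => ∑ c, (errorVec G A pd p c + τ * d c) ^ 2 / 2) 0 :=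
    ContDiffAt.sum fun c _ =>
      ((contDiffAt_const.add (contDiffAt_id.mul contDiffAt_const)).pow 2).div_const 2
  have hd : HasDerivAt (fun τ : ℝ => ∑ c, (errorVec G A pd p c + τ * d c) ^ 2 / 2)
      (∑ c, errorVec G A pd p c * d c) 0 := by
    refine HasDerivAt.fun_sum fun c _ => ?_
    refine (((((hasDerivAt_id (0 : ℝ)).mul_const (d c)).const_add _).pow 2).div_const
      2).congr_deriv ?_
    simp
    ring
  rw [fderiv_fderiv_apply_self_of_eq_comp_sq (contDiffAt_errorPotential pd hp) hh ?_, hd.deriv,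
    edgeWeight, dif_pos gij]
  · simp [d, Pi.single_apply]
  · filter_upwards [gt_mem_nhds (zero_lt_one (α := ℝ))] with t ht
    refine Finset.sum_congr rfl fun c _ => ?_
    congr 2
    rcases c with s | a
    · simp only [errorVec, weakRigidityFun, hedge]
      ring
    · have hda : d (Sum.inr a) = 0 := by simp [d]
      simp only [errorVec, weakRigidityFun, hangle a t ht, hda]
      ring

/-! ### Negative curvature at incorrect equilibria and the theorem -/

/-- At every incorrect equilibrium the potential has a direction of negative curvature. -/
theorem exists_fderiv_fderiv_errorPotential_neg {G : SimpleGraph (Fin 3)} [DecidableRel G.Adj]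
    {A : Finset (Fin 3 × Fin 3 × Fin 3)} {pd p : Config 3} (h : IsMinimallyGIWR G A pd)
    (hp : p ∈ incorrectEquilibria G A pd) :
    ∃ v, fderiv ℝ (fderiv ℝ (errorPotential G A pd)) p v v < 0 := by
  by_cases hcol : Collinear ℝ (Set.range (agent p))
  · obtain ⟨u, m, p₀, r, -, hm, hum, hr⟩ := hcol.exists_direction_normal
    have hneg := stressForm_coeffMatrix_desired_neg h.1.1 h.1.not_collinear hp hcol
    -- The form is a sum over the two coordinates, so it is negative on one coordinate vector of the
    -- desired configuration.
    obtain ⟨a, -, ha⟩ : ∃ a ∈ Finset.univ, _ < (0 : ℝ) := by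
      by_contra! hcon
      exact absurd hneg (not_lt.2 (Finset.sum_nonneg hcon))
    refine ⟨tensorMotion (fun i => pd (i, a)) m, ?_⟩
    rw [fderiv_fderiv_errorPotential_of_normal pd hp.1
      (inner_relPos_tensorMotion_of_normal hr hum _), stressForm_tensorMotion _ _ hm]
    exact ha
  · have hE : weightedMatrix G A p (errorVec G A pd p) = 0 :=
      eq_zero_of_stressForm_eq_zero (isHermitian_weightedMatrix _ _ _ _)
        (weightedMatrix_mulVec_one _ _ _ _) hcol fun v => by
          rw [← coeffMatrix_eq_weightedMatrix, stressForm_coeffMatrix_eq_zero hp]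
    obtain ⟨k, i, j, a, hki, hkj, hij, hak, hall, gij, gki, gkj, -, hla, hin, s1, s2⟩ :=
      exists_right_angle_of_dependent h hcol hE hp.2.2
    have hpn : ∀ x y : Fin 3, x ≠ y → relPos p x y ≠ 0 := fun x y hxy =>
      relPos_ne_zero_of_not_collinear hcol hxy
    have hX := norm_pos_iff.2 (hpn _ _ hki)
    have hY := norm_pos_iff.2 (hpn _ _ hij)
    have hZ := norm_pos_iff.2 (hpn _ _ hkj)
    -- A positive angle error would give `e_ij > 0` and `e_ki < 0`: the desired triangle has a
    -- shorter `ij` and a longer `ki`, hence a cosine at `k` at least as large, contradicting the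
    -- sign.
    have hea : errorVec G A pd p (Sum.inr a) < 0 := by
      refine lt_of_le_of_ne ?_ hla
      by_contra! hpos
      have hq : 0 < errorVec G A pd p (Sum.inr a) / (‖relPos p k i‖ * ‖relPos p k j‖) :=
        div_pos hpos (by positivity)
      have hq2 := mul_pos hq (div_pos (pow_pos hY 2) (pow_pos hX 2))
      rw [edgeWeight_errorVec pd p gij] at s1
      rw [edgeWeight_errorVec pd p gki] at s2
      have hle := cosAngle_le_of_right_angle (q := pd) (hpn _ _ hki) (hpn _ _ hkj)
        (relPos_ne_zero_of_not_collinear h.1.not_collinear hkj) hin (by linarith) (by linarith)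
      have had := h.ne_of_mem a.2
      rw [← cosAngle_eq_of_vertex had hak hki hkj hij,
        ← cosAngle_eq_of_vertex had hak hki hkj hij] at hle
      simp only [errorVec, weakRigidityFun] at hpos
      linarith
    have hq : errorVec G A pd p (Sum.inr a) / (‖relPos p k i‖ * ‖relPos p k j‖) < 0 :=
      div_neg_of_neg_of_pos hea (by positivity)
    refine ⟨_, (fderiv_fderiv_errorPotential_of_right_angle pd hp.1 hki hkj hij gij gkj hin
      fun b hb => ?_).trans_lt ?_⟩
    · refine ⟨?_, h.ne_of_mem hb⟩
      rw [← hak, ← hall ⟨b, hb⟩]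
    · have : edgeWeight (errorVec G A pd p) i j < 0 := by linarith
      nlinarith [mul_neg_of_neg_of_pos this (pow_pos hZ 2)]

theorem mainTheorem9 (G : SimpleGraph (Fin 3)) [DecidableRel G.Adj]
    (A : Finset (Fin 3 × Fin 3 × Fin 3)) (pd : Config 3) (hpd : IsMinimallyGIWR G A pd)
    (pbar : Config 3) (hpbar : pbar ∈ incorrectEquilibria G A pd) :
    -- the incorrect equilibrium is unstable
    ¬ IsLyapunovStable (domainSet A) (controlField G A pd) pbar ∧
    -- the negative Jacobian there has a negative eigenvalue
    (∃ μ < 0, Module.End.HasEigenvalue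
      (negJacobian G A pd pbar : Config 3 →ₗ[ℝ] Config 3) μ) ∧
    -- the agents are collinear; when there are exactly two distance constraints, this is claimed
    -- for an angle constraint subtended by these two edges
    ((G.edgeSet.ncard = 2 → ∀ a ∈ A, G.Adj a.1 a.2.1 ∧ G.Adj a.1 a.2.2) →
      Collinear ℝ (Set.range (agent pbar))) ∧
    -- where they are collinear, `E(pbar)` is not positive semidefinite: it has a negative eigenvalue
    (Collinear ℝ (Set.range (agent pbar)) →
      ∃ μ < 0, Module.End.HasEigenvalue (Matrix.toLin' (coeffMatrix G A pd pbar)) μ) := by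
  obtain ⟨v, hv⟩ := exists_fderiv_fderiv_errorPotential_neg hpd hpbar
  have hsymm := isSymmetric_fderiv_controlField (G := G) pd hpbar.1
  have hJ : 0 < inner ℝ (fderiv ℝ (controlField G A pd) pbar v) v := by
    rw [inner_fderiv_controlField pd hpbar.1]
    linarith
  refine ⟨?_, ?_, fun hsub => ?_, fun hcol => ?_⟩
  · refine not_isLyapunovStable_of_fderiv ((isOpen_domainSet A).mem_nhds hpbar.1)
      (contDiffAt_controlField pd hpbar.1) ?_ hsymm hJ
    rw [controlField, hpbar.2.1, neg_zero]
    rfl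
  · refine LinearMap.IsSymmetric.exists_neg_hasEigenvalue (v := v) (fun x y => ?_) ?_
    · have := hsymm x y
      simpa [negJacobian, inner_neg_left, inner_neg_right] using this
    · simpa [negJacobian, inner_neg_left] using hJ
  · by_contra hcol
    have hE : weightedMatrix G A pbar (errorVec G A pd pbar) = 0 :=
      eq_zero_of_stressForm_eq_zero (isHermitian_weightedMatrix _ _ _ _)
        (weightedMatrix_mulVec_one _ _ _ _) hcol fun v => by
          rw [← coeffMatrix_eq_weightedMatrix, stressForm_coeffMatrix_eq_zero hpbar]
    -- Off a line only the exception remains, where `kj` is not an edge although it is an arm of the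
    -- angle at `k`; the hypothesis on two distances excludes this.
    obtain ⟨k, i, j, a, hki, hkj, hij, hak, -, -, -, gkj, hcard, -⟩ :=
      exists_right_angle_of_dependent hpd hcol hE hpbar.2.2
    have hnc : G.edgeSet.ncard = 2 := by
      rw [← hcard, ← SimpleGraph.coe_edgeFinset, Set.ncard_coe_finset]
    obtain ⟨g1, g2⟩ := hsub hnc a.1 a.2
    obtain ⟨n1, n2, n3⟩ := hpd.ne_of_mem a.2
    have hj : j = a.1.2.1 ∨ j = a.1.2.2 := by lia
    rcases hj with rfl | rfl
    · exact gkj (hak ▸ g1)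
    · exact gkj (hak ▸ g2)
  · have hneg := stressForm_coeffMatrix_desired_neg hpd.1.1 hpd.1.not_collinear hpbar hcol
    obtain ⟨a, -, ha⟩ : ∃ a ∈ Finset.univ, _ < (0 : ℝ) := by
      by_contra! hcon
      exact absurd hneg (not_lt.2 (Finset.sum_nonneg hcon))
    exact (isHermitian_coeffMatrix G A pd pbar).exists_neg_hasEigenvalue ha
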